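/- For $d\ge 1$ let $\mathrm{Sym}^n(\mathbb{C}^d)\subset(\mathbb{C}^d)^{\otimes n}$ be the subspace of vectors invariant under all permutations of the $n$ tensor factors, let $g\in SU(d)$ act on $(\mathbb{C}^d)^{\otimes n}$ by $g^{\otimes n}$, and let $\|A\|=\tfrac12\mathrm{tr}\sqrt{A^\dagger A}$. The weights of $\mathrm{Sym}^k(\mathbb{C}^d)$ are the $d$-tuples $w=(w_1,\dots,w_d)$ of nonnegative integers with $\sum_j w_j=k$; the weight space of $w$ consists of the $\varphi\in\mathrm{Sym}^k(\mathbb{C}^d)$ with $h^{\otimes k}\varphi=\prod_j h_j^{w_j}\,\varphi$ for every diagonal $h=\mathrm{diag}(h_1,\dots,h_d)\in SU(d)$. Let $\mathcal{W}^{\downarrow r}$ be the set of weights $w$ of $\mathrm{Sym}^k(\mathbb{C}^d)$ with $(k,0,\dots,0)-w=\sum_{i=1}^{d-1} n_i\alpha_i$ for integers $n_i$ with $\max_i|n_i|\le r$, where $\alpha_i=(0,\dots,0,1,-1,0,\dots,0)$ (with the $1$ in position $i$) are the simple roots; equivalently $w_1\ge k-r$. A $\mathcal{W}^r$-state is a state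 $g^{\otimes k}|\varphi\rangle$ with $g\in SU(d)$ and $|\varphi\rangle$ a unit vector in the sum of the weight spaces of the weights in $\mathcal{W}^{\downarrow r}$. Let $0\le r\le k\le n$ and set $$\varepsilon_{n,k,r,d}:=2\,\frac{\dim \mathrm{Sym}^{n-k}(\mathbb{C}^d)}{\dim \mathrm{Sym}^{n}(\mathbb{C}^d)}\sum_{i=r+1}^{k}\frac{\binom{k}{i}}{\binom{n}{i}}\binom{i+d-2}{i}.$$ Then for every unit vector $|\Psi\rangle\in\mathrm{Sym}^n(\mathbb{C}^d)$ the partial trace $\mathrm{tr}_{n-k}|\Psi\rangle\langle\Psi|$ over $n-k$ of the tensor factors is approximated by a convex combination of $\mathcal{W}^r$-states in $\mathrm{Sym}^k(\mathbb{C}^d)$ with error $\varepsilon_{n,k,r,d}$: there are a Borel probability measure $m$ on $SU(d)$ and unit vectors $|\varphi_{(g)}\rangle$, depending measurably on $g\in SU(d)$ and lying in the sum of the weight spaces of the weights in $\mathcal{W}^{\downarrow r}$, such that, with $|\chi_{(g)}\rangle=g^{\otimes k}|\varphi_{(g)}\rangle$, $$\Bigl\|\mathrm{tr}_{n-k}|\Psi\rangle\langle\Psi|-\int|\chi_{(g)}\rangle\langle\chi_{(g)}|\,dm(g)\Bigr\|\le\varepsilon_{n,k,r,d}.$$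 In particular: (i) if $r=0$, then $\varepsilon_{n,k,0,d}=2\Bigl(1-\frac{\dim\mathrm{Sym}^{n-k}(\mathbb{C}^d)}{\dim\mathrm{Sym}^{n}(\mathbb{C}^d)}\Bigr)$; (ii) if $2\le d\le\min\{k,n-k\}$, then $$\varepsilon_{n,k,r,d}\le 2\,\frac{e^{3d}}{(d-2)!}\Bigl(\frac{k}{n-r}\Bigr)^{r+1}\Bigl(\frac{k(n-k)}{n-r}\Bigr)^{d-2}.$$ -/

import Mathlib

namespace DeFinetti

open MeasureTheory

/-- The Hilbert space `(ℂ^d)^{⊗n}` in its standard product basis `|v₁⟩ ⊗ ⋯ ⊗ |vₙ⟩`, which is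
indexed by the tuples `v : Fin n → Fin d`. -/
abbrev TensorSpace (d n : ℕ) : Type := EuclideanSpace ℂ (Fin n → Fin d)

/-- The symmetric subspace `Sym^n(ℂ^d)` of `(ℂ^d)^{⊗n}`: the vectors which are invariant under all
permutations of the tensor factors. The permutation `π` maps
`φ₁ ⊗ ⋯ ⊗ φₙ` to `φ_{π⁻¹(1)} ⊗ ⋯ ⊗ φ_{π⁻¹(n)}`, that is, in coordinates,
`(π ψ) v = ψ (v ∘ π)`. -/
noncomputable def symSubspace (d n : ℕ) : Submodule ℂ (TensorSpace d n) where
  carrier := {ψ | ∀ (π : Equiv.Perm (Fin n)) (v : Fin n → Fin d), ψ (v ∘ π) = ψ v}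
  zero_mem' := by intro π v; simp
  add_mem' := by
    intro a b ha hb π v
    simp [ha π v, hb π v]
  smul_mem' := by
    intro c a ha π v
    simp [ha π v]

/-- The special unitary group `SU(d)`. -/
abbrev SU (d : ℕ) : Type := Matrix.specialUnitaryGroup (Fin d) ℂ

/-- `SU(d)` carries its Borel σ-algebra. -/
noncomputable instance instMeasurableSpaceSU (d : ℕ) : MeasurableSpace (SU d) := borel (SU d)

noncomputable instance instBorelSpaceSU (d : ℕ) : BorelSpace (SU d) := ⟨rfl⟩

/-- The action `U^{⊗n}` of a matrix `U` on `(ℂ^d)^{⊗n}`; its matrix in the product basis has the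
entries `∏ i, U (v i) (u i)`. -/
noncomputable def tensorPower {d : ℕ} (n : ℕ) (U : Matrix (Fin d) (Fin d) ℂ)
    (ψ : TensorSpace d n) : TensorSpace d n :=
  WithLp.toLp 2 (fun v => ∑ u : Fin n → Fin d, (∏ i, U (v i) (u i)) * ψ u)

/-- The space of vectors of weight `w` in `Sym^n(ℂ^d)`: every diagonal matrix
`h = diag(h₁, …, h_d)` in `SU(d)` acts on them as multiplication by `∏ j, h_j ^ {w_j}`. -/
noncomputable def weightSpace (d n : ℕ) (w : Fin d → ℕ) : Submodule ℂ (TensorSpace d n) where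
  carrier := {ψ | ψ ∈ symSubspace d n ∧
    ∀ h : Fin d → ℂ, Matrix.diagonal h ∈ Matrix.specialUnitaryGroup (Fin d) ℂ →
      tensorPower n (Matrix.diagonal h) ψ = (∏ j, h j ^ w j) • ψ}
  zero_mem' := by
    refine ⟨Submodule.zero_mem _, fun h _ => ?_⟩
    ext v
    simp [tensorPower]
  add_mem' := by
    rintro a b ⟨ha, ha'⟩ ⟨hb, hb'⟩
    refine ⟨Submodule.add_mem _ ha hb, fun h hh => ?_⟩
    rw [smul_add, ← ha' h hh, ← hb' h hh]
    ext v
    simp [tensorPower, mul_add, Finset.sum_add_distrib]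
  smul_mem' := by
    rintro c a ⟨ha, ha'⟩
    refine ⟨Submodule.smul_mem _ c ha, fun h hh => ?_⟩
    rw [smul_comm, ← ha' h hh]
    ext v
    simp only [tensorPower, PiLp.smul_apply, smul_eq_mul, Finset.mul_sum]
    exact Finset.sum_congr rfl fun u _ => by ring

/-- The weights of `Sym^n(ℂ^d)`: the `d`-tuples of nonnegative integers with sum `n`. (Tuples with
the same sum are distinguished by the characters which they define on the diagonal subgroup of
`SU(d)`.) -/
def weights (d n : ℕ) : Set (Fin d → ℕ) := {w | ∑ j, w j = n}

/-- The highest weight `(n, 0, …, 0)` of `Sym^n(ℂ^d)`. -/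
def highestWeight (d n : ℕ) (j : Fin d) : ℤ := if (j : ℕ) = 0 then n else 0

/-- The simple roots `α_i = (0, …, 0, 1, -1, 0, …, 0)`, for `i = 1, …, d - 1`. -/
def simpleRoot (d : ℕ) (i : Fin (d - 1)) (j : Fin d) : ℤ :=
  if (j : ℕ) = i then 1 else if (j : ℕ) = i + 1 then -1 else 0

/-- The weights of `Sym^n(ℂ^d)` within distance `r` of the highest weight `λ`: the weights `w` with
`λ - w = ∑ i, n_i α_i` and `max |n_i| ≤ r`. -/
def highWeights (d n r : ℕ) : Set (Fin d → ℕ) :=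
  {w | w ∈ weights d n ∧ ∃ c : Fin (d - 1) → ℤ,
    (∀ j, highestWeight d n j - (w j : ℤ) = ∑ i, c i * simpleRoot d i j) ∧
    ∀ i, |c i| ≤ (r : ℤ)}

/-- The subspace of `Sym^n(ℂ^d)` spanned by the weight vectors whose weights lie within distance
`r` of the highest weight. -/
noncomputable def highWeightSpace (d n r : ℕ) : Submodule ℂ (TensorSpace d n) :=
  ⨆ w ∈ highWeights d n r, weightSpace d n w

/-- The operator `|ψ⟩⟨ψ|` as a matrix in the product basis. -/
noncomputable def proj {d n : ℕ} (ψ : TensorSpace d n) : Matrix (Fin n → Fin d) (Fin n → Fin d) ℂ :=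
  Matrix.of fun u v => ψ u * star (ψ v)

/-- The partial trace `tr_{n-k}` over the last `n - k` of the `n` tensor factors. -/
noncomputable def partialTrace {d n k : ℕ} (hkn : k ≤ n) (A : Matrix (Fin n → Fin d) (Fin n → Fin d) ℂ) :
    Matrix (Fin k → Fin d) (Fin k → Fin d) ℂ :=
  Matrix.of fun u v => ∑ t : Fin (n - k) → Fin d,
    A (Fin.append u t ∘ Fin.cast (Nat.add_sub_of_le hkn).symm)
      (Fin.append v t ∘ Fin.cast (Nat.add_sub_of_le hkn).symm)

/-- The trace norm with the normalisation `‖A‖ = (1/2) tr √(A† A)`; the trace of `√(A† A)` is the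
sum of the square roots of the eigenvalues of `A† A`, with multiplicity. -/
noncomputable def traceNorm {ι : Type*} [Fintype ι] [DecidableEq ι] (A : Matrix ι ι ℂ) : ℝ :=
  (1 / 2) * ∑ i, √((Matrix.isHermitian_conjTranspose_mul_self A).eigenvalues i)

/-- The mixture `∫ |χ_g⟩⟨χ_g| dm(g)`; the integral is taken entry by entry. -/
noncomputable def mixture {d n : ℕ} (m : Measure (SU d)) (χ : SU d → TensorSpace d n) :
    Matrix (Fin n → Fin d) (Fin n → Fin d) ℂ :=
  Matrix.of fun u v => ∫ g, proj (χ g) u v ∂m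

/-- `dim Sym^n(ℂ^d)`, as a real number. -/
noncomputable def dimSym (d n : ℕ) : ℝ := (Module.finrank ℂ (symSubspace d n) : ℝ)

/-- The error `ε_{n,k,r,d}`. -/
noncomputable def errorBound (n k r d : ℕ) : ℝ :=
  2 * (dimSym d (n - k) / dimSym d n) *
    ∑ i ∈ Finset.Icc (r + 1) k,
      ((k.choose i : ℝ) / (n.choose i : ℝ)) * ((i + d - 2).choose i : ℝ)

end DeFinetti

namespace DeFinetti

open MeasureTheory Matrix
open scoped ComplexOrder

/-! ### Compactness of the special unitary group and its Haar measure -/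

section Group

variable {d : ℕ}

/-! Split the n factors into k kept and m = n - k traced ones, and let D be the dimension of the
symmetric subspace of the m factors. Contracting Ψ with the coherent state (g e₀)^{⊗m} gives an
unnormalised vector χ_g on the k factors. Let P be the projection onto product basis vectors with at
most r entries different from e₀, and put a_g = g^{⊗k} P (g^{⊗k})† χ_g. Normalised and rotated back
by g, the vector a_g lies in the high weight space; it provides the approximating states.

All averages over Haar measure come from one Schur-type fact (`twirl_mulVec`): the conjugates of a
diagonal operator by g^{⊗n} average to a scalar on symmetric tensors. Applied to P ⊗ |e₀⟩⟨e₀|^{⊗m},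
it shows that |a_g⟩⟨χ_g| averages to qρ, where ρ is the reduced state and q is `lowMass`
(`average_weighted`). For r = k this says that |χ_g⟩⟨χ_g| averages to ρ/D.

Put δ = 1 - Dq. Expanding |χ - a⟩⟨χ - a| gives D·avg|a⟩⟨a| = (1 - 2δ)ρ + D·B, where B = avg|χ - a⟩⟨χ
- a| is positive semidefinite and D·B has trace δ. The left side has trace only 1 - δ, so the
density D‖a_g‖² is raised by the constant δ. This adds δS for a state S, and ρ minus the mixture
becomes 2δρ - (D·B + δS): a difference of two positive operators of trace 2δ each, hence of halved
trace norm at most 2δ (`exists_mixture_of_symm`).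

It remains to identify 2δ with the stated error. The scalar q is a combination of the moments of
|g₀₀|² and 1 - |g₀₀|². The pure powers integrate to inverse dimensions by a trace computation
(`moment_zero_mul_dimSym`), and a difference recursion gives the others (`moment_eq`). Summed over
all excitation numbers the combination is 1/D, so 2δ is the tail beyond r (`errorBound_eq`). -/

instance instIsTopologicalGroupSU : IsTopologicalGroup (SU d) where
  continuous_mul := continuous_mul
  continuous_inv := by
    refine continuous_induced_rng.2 ?_
    exact (continuous_star.comp continuous_subtype_val :
      Continuous fun g : SU d => star (g : Matrix (Fin d) (Fin d) ℂ))

instance instCompactSpaceSU : CompactSpace (SU d) := by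
  refine isCompact_iff_compactSpace.1 ?_
  have hK : IsCompact (Set.pi Set.univ fun _ : Fin d => Set.pi Set.univ fun _ : Fin d =>
      Metric.closedBall (0 : ℂ) 1) :=
    isCompact_univ_pi fun _ => isCompact_univ_pi fun _ => isCompact_closedBall _ _
  refine hK.of_isClosed_subset ?_ ?_
  · have h1 : IsClosed {A : Matrix (Fin d) (Fin d) ℂ | star A * A = 1 ∧ A * star A = 1} :=
      (isClosed_eq (continuous_star.mul continuous_id) continuous_const).inter
        (isClosed_eq (continuous_id.mul continuous_star) continuous_const)
    have h2 : IsClosed {A : Matrix (Fin d) (Fin d) ℂ | A.det = 1} :=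
      isClosed_eq (continuous_id.matrix_det) continuous_const
    exact h1.inter h2
  · intro A hA i _ j _
    simpa using entry_norm_bound_of_unitary (mem_specialUnitaryGroup_iff.1 hA).1 i j

/-- The normalised Haar measure on `SU(d)`. -/
noncomputable def haarSU (d : ℕ) : Measure (SU d) := Measure.haarMeasure ⊤

instance instIsProbabilityMeasureHaarSU : IsProbabilityMeasure (haarSU d) :=
  ⟨by simpa using! Measure.haarMeasure_self (K₀ := (⊤ : TopologicalSpace.PositiveCompacts (SU d)))⟩

instance instIsMulLeftInvariantHaarSU : (haarSU d).IsMulLeftInvariant :=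
  Measure.isMulLeftInvariant_haarMeasure _

theorem integrable_haarSU {f : SU d → ℂ} (hf : Continuous f) : Integrable f (haarSU d) :=
  hf.integrable_of_hasCompactSupport (HasCompactSupport.of_compactSpace f)

theorem integrable_haarSU_real {f : SU d → ℝ} (hf : Continuous f) : Integrable f (haarSU d) :=
  hf.integrable_of_hasCompactSupport (HasCompactSupport.of_compactSpace f)

end Group

/-! ### Matrix-valued Haar averages -/

section EntrywiseIntegral

variable {d : ℕ} {α β γ : Type*}

/-- The entrywise integral over `SU(d)` of a matrix-valued function. -/
noncomputable def average (F : SU d → Matrix α β ℂ) : Matrix α β ℂ :=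
  of fun u v => ∫ g, F g u v ∂haarSU d

theorem integrable_entry {F : SU d → Matrix α β ℂ} (hF : Continuous F) (u : α) (v : β) :
    Integrable (fun g => F g u v) (haarSU d) :=
  integrable_haarSU (hF.matrix_elem u v)

theorem mul_average [Fintype α] (A : Matrix γ α ℂ) {F : SU d → Matrix α β ℂ} (hF : Continuous F) :
    A * average F = average fun g => A * F g := by
  ext u v
  simp only [average, mul_apply, of_apply]
  rw [integral_finsetSum _ fun i _ => (integrable_entry hF i v).const_mul _]
  simp only [integral_const_mul]

theorem average_mul [Fintype β] (B : Matrix β γ ℂ) {F : SU d → Matrix α β ℂ} (hF : Continuous F) :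
    average F * B = average fun g => F g * B := by
  ext u v
  simp only [average, mul_apply, of_apply]
  rw [integral_finsetSum _ fun i _ => (integrable_entry hF u i).mul_const _]
  simp only [integral_mul_const]

theorem average_mul_left (h : SU d) (F : SU d → Matrix α β ℂ) :
    (average fun g => F (h * g)) = average F := by
  ext u v
  exact integral_mul_left_eq_self (fun g => F g u v) h

theorem average_mulVec [Fintype β] (x : β → ℂ) {F : SU d → Matrix α β ℂ}
    (hF : ∀ u v, Integrable (fun g => F g u v) (haarSU d)) (u : α) :
    (average F *ᵥ x) u = ∫ g, (F g *ᵥ x) u ∂haarSU d := by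
  simp only [average, mulVec, dotProduct, of_apply]
  rw [integral_finsetSum _ fun i _ => (hF u i).mul_const _]
  simp only [integral_mul_const]

theorem average_add {F G : SU d → Matrix α β ℂ} (hF : Continuous F) (hG : Continuous G) :
    (average fun g => F g + G g) = average F + average G := by
  ext u v
  exact integral_add (integrable_entry hF u v) (integrable_entry hG u v)

theorem average_sub {F G : SU d → Matrix α β ℂ} (hF : Continuous F) (hG : Continuous G) :
    (average fun g => F g - G g) = average F - average G := by
  ext u v
  exact integral_sub (integrable_entry hF u v) (integrable_entry hG u v)

theorem trace_average [Fintype α] {F : SU d → Matrix α α ℂ}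
    (hF : ∀ u v, Integrable (fun g => F g u v) (haarSU d)) :
    (average F).trace = ∫ g, (F g).trace ∂haarSU d := by
  simp only [average, trace, diag, of_apply]
  rw [integral_finsetSum _ fun i _ => hF i i]

theorem average_conjTranspose (F : SU d → Matrix α β ℂ) :
    (average fun g => (F g)ᴴ) = (average F)ᴴ := by
  ext u v
  simp only [average, of_apply, conjTranspose_apply]
  exact integral_conj

theorem posSemidef_average [Fintype α] {F : SU d → Matrix α α ℂ}
    (hF : ∀ u v, Integrable (fun g => F g u v) (haarSU d))
    (h : ∀ g, (F g).PosSemidef) : (average F).PosSemidef := by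
  refine PosSemidef.of_dotProduct_mulVec_nonneg ?_ fun x => ?_
  · rw [IsHermitian, ← average_conjTranspose]
    simp only [fun g => (h g).isHermitian.eq]
  · have : star x ⬝ᵥ average F *ᵥ x = ∫ g, star x ⬝ᵥ F g *ᵥ x ∂haarSU d := by
      simp only [dotProduct, average_mulVec x hF]
      rw [integral_finsetSum]
      · simp only [integral_const_mul]
      · intro i _
        exact (integrable_finsetSum _ fun j _ => (hF i j).mul_const _).const_mul _
    rw [this]
    exact integral_nonneg fun g => (h g).dotProduct_mulVec_nonneg x

end EntrywiseIntegral

/-! ### Tensor powers of matrices and symmetric tensors -/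

section TensorPower

variable {d : ℕ} {ι κ τ : Type*} [Fintype ι] [Fintype κ] [Fintype τ]

/-- The matrix of `U^{⊗ι}` in the product basis. -/
def kroneckerPower (ι : Type*) [Fintype ι] (U : Matrix (Fin d) (Fin d) ℂ) :
    Matrix (ι → Fin d) (ι → Fin d) ℂ :=
  of fun u w => ∏ i, U (u i) (w i)

theorem kroneckerPower_apply (U : Matrix (Fin d) (Fin d) ℂ) (u w : ι → Fin d) :
    kroneckerPower ι U u w = ∏ i, U (u i) (w i) := rfl

theorem kroneckerPower_mul [DecidableEq ι] (U V : Matrix (Fin d) (Fin d) ℂ) :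
    kroneckerPower ι (U * V) = kroneckerPower ι U * kroneckerPower ι V := by
  ext u w
  simp only [kroneckerPower_apply, mul_apply, Fintype.prod_sum, Finset.prod_mul_distrib]

theorem kroneckerPower_diagonal (x : Fin d → ℂ) :
    kroneckerPower ι (diagonal x) = diagonal fun u => ∏ i, x (u i) := by
  classical
  ext u w
  by_cases h : u = w
  · subst h; simp [kroneckerPower_apply]
  · obtain ⟨i, hi⟩ := Function.ne_iff.1 h
    rw [diagonal_apply_ne _ h, kroneckerPower_apply]
    exact Finset.prod_eq_zero (Finset.mem_univ i) (diagonal_apply_ne _ hi)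

theorem kroneckerPower_one : kroneckerPower ι (1 : Matrix (Fin d) (Fin d) ℂ) = 1 := by
  rw [← diagonal_one, kroneckerPower_diagonal]
  simp

theorem kroneckerPower_conjTranspose (U : Matrix (Fin d) (Fin d) ℂ) :
    (kroneckerPower ι U)ᴴ = kroneckerPower ι Uᴴ := by
  ext u w
  simp [kroneckerPower_apply]

theorem SU.conjTranspose_mul (g : SU d) :
    (g : Matrix (Fin d) (Fin d) ℂ)ᴴ * (g : Matrix (Fin d) (Fin d) ℂ) = 1 :=
  (mem_specialUnitaryGroup_iff.1 g.2).1.1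

theorem SU.mul_conjTranspose (g : SU d) :
    (g : Matrix (Fin d) (Fin d) ℂ) * (g : Matrix (Fin d) (Fin d) ℂ)ᴴ = 1 :=
  (mem_specialUnitaryGroup_iff.1 g.2).1.2

theorem kroneckerPower_conjTranspose_mul [DecidableEq ι] (g : SU d) :
    (kroneckerPower ι (g : Matrix (Fin d) (Fin d) ℂ))ᴴ * kroneckerPower ι g.1 = 1 := by
  rw [kroneckerPower_conjTranspose, ← kroneckerPower_mul, SU.conjTranspose_mul, kroneckerPower_one]

theorem kroneckerPower_mul_conjTranspose [DecidableEq ι] (g : SU d) :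
    kroneckerPower ι (g : Matrix (Fin d) (Fin d) ℂ) * (kroneckerPower ι g.1)ᴴ = 1 := by
  rw [kroneckerPower_conjTranspose, ← kroneckerPower_mul, SU.mul_conjTranspose, kroneckerPower_one]

theorem continuous_kroneckerPower :
    Continuous fun g : SU d => kroneckerPower ι (g : Matrix (Fin d) (Fin d) ℂ) :=
  continuous_matrix fun u w => continuous_finsetProd _ fun i _ =>
    continuous_subtype_val.matrix_elem (u i) (w i)

/-- Invariance of a tensor under all permutations of its factors. -/
def IsSymmTensor (Ψ : (ι → Fin d) → ℂ) : Prop := ∀ (π : Equiv.Perm ι) (u : ι → Fin d), Ψ (u ∘ π) = Ψ u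

theorem IsSymmTensor.mulVec {Ψ : (ι → Fin d) → ℂ} (hΨ : IsSymmTensor Ψ)
    (U : Matrix (Fin d) (Fin d) ℂ) [DecidableEq ι] : IsSymmTensor (kroneckerPower ι U *ᵥ Ψ) := by
  intro π u
  simp only [Matrix.mulVec, dotProduct, kroneckerPower_apply]
  refine (Fintype.sum_equiv (Equiv.arrowCongr π.symm (Equiv.refl (Fin d))) _ _ fun w => ?_).symm
  have h : (Equiv.arrowCongr π.symm (Equiv.refl (Fin d))) w = w ∘ π := by
    ext i; simp [Equiv.arrowCongr]
  rw [h, hΨ π w]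
  congr 1
  exact (Equiv.prod_comp π fun i => U (u i) (w i)).symm

/-- The number of occurrences of each basis vector in a product basis vector. -/
def weightOf (u : ι → Fin d) (a : Fin d) : ℕ := (Finset.univ.filter fun i => u i = a).card

theorem prod_eq_prod_pow_weightOf (x : Fin d → ℂ) (u : ι → Fin d) :
    ∏ i, x (u i) = ∏ a, x a ^ weightOf u a := by
  rw [← Finset.prod_fiberwise (s := Finset.univ) (g := u)]
  refine Finset.prod_congr rfl fun a _ => ?_
  rw [Finset.prod_congr rfl (g := fun _ => x a) fun i hi => by rw [(Finset.mem_filter.1 hi).2],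
    Finset.prod_const, weightOf]

theorem sum_weightOf (u : ι → Fin d) : ∑ a, weightOf u a = Fintype.card ι := by
  simp only [weightOf]
  rw [← Finset.card_eq_sum_card_fiberwise (fun _ _ => Finset.mem_coe.2 (Finset.mem_univ _)), Finset.card_univ]

theorem exists_perm_of_weightOf_eq {u w : ι → Fin d} (h : weightOf u = weightOf w) :
    ∃ π : Equiv.Perm ι, u = w ∘ π := by
  classical
  have e : ∀ a, Nonempty ({i // u i = a} ≃ {i // w i = a}) := fun a => by
    rw [← Fintype.card_eq, Fintype.card_subtype, Fintype.card_subtype]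
    exact congrFun h a
  let E : ∀ a, {i // u i = a} ≃ {i // w i = a} := fun a => (e a).some
  refine ⟨(Equiv.sigmaFiberEquiv u).symm.trans
    ((Equiv.sigmaCongrRight E).trans (Equiv.sigmaFiberEquiv w)), ?_⟩
  ext i
  simp only [Function.comp_apply, Equiv.trans_apply, Equiv.sigmaFiberEquiv,
    Equiv.coe_fn_symm_mk, Equiv.coe_fn_mk, Equiv.sigmaCongrRight_apply]
  exact congrArg Fin.val (E (u i) ⟨i, rfl⟩).2.symm

theorem weightOf_comp_perm (u : ι → Fin d) (π : Equiv.Perm ι) : weightOf (u ∘ π) = weightOf u := by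
  funext a
  refine Finset.card_equiv π fun i => ?_
  simp

theorem IsSymmTensor.eq_of_weightOf_eq {Ψ : (ι → Fin d) → ℂ} (hΨ : IsSymmTensor Ψ)
    {u w : ι → Fin d} (h : weightOf u = weightOf w) : Ψ u = Ψ w := by
  obtain ⟨π, rfl⟩ := exists_perm_of_weightOf_eq h
  exact hΨ π w

/-- A linear form which vanishes on all the powers `v^{⊗ι}` vanishes on all symmetric tensors. -/
theorem IsSymmTensor.dotProduct_eq_zero [DecidableEq ι] {Ψ : (ι → Fin d) → ℂ} (hΨ : IsSymmTensor Ψ)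
    (l : (ι → Fin d) → ℂ) (hl : ∀ v : Fin d → ℂ, ∑ u, l u * ∏ i, v (u i) = 0) :
    ∑ u, l u * Ψ u = 0 := by
  classical
  -- Evaluated on v^{⊗ι}, the form is this polynomial in v. Its coefficient at w is the sum of `l`
  -- over the tuples of weight w, and a symmetric tensor is constant on those tuples.
  let P : MvPolynomial (Fin d) ℂ :=
    ∑ u, MvPolynomial.monomial (Finsupp.equivFunOnFinite.symm (weightOf u)) (l u)
  have hP : P = 0 := MvPolynomial.funext fun v => by
    rw [map_zero, ← hl v, map_sum]
    refine Finset.sum_congr rfl fun u _ => ?_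
    rw [MvPolynomial.eval_monomial, prod_eq_prod_pow_weightOf, Finsupp.prod_fintype _ _ (by simp)]
    rfl
  have hc : ∀ w : Fin d → ℕ, ∑ u with weightOf u = w, l u = 0 := fun w => by
    have := congrArg (MvPolynomial.coeff (Finsupp.equivFunOnFinite.symm w)) hP
    rw [MvPolynomial.coeff_zero, MvPolynomial.coeff_sum] at this
    refine (Finset.sum_filter _ _).trans (Eq.trans ?_ this)
    refine Finset.sum_congr rfl fun u _ => ?_
    rw [MvPolynomial.coeff_monomial]
    simp only [EmbeddingLike.apply_eq_iff_eq]
  rw [← Finset.sum_fiberwise_of_maps_to (t := Finset.univ.image weightOf)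
    (fun u _ => Finset.mem_image_of_mem weightOf (Finset.mem_univ u))]
  refine Finset.sum_eq_zero fun w hw => ?_
  obtain ⟨u₀, -, rfl⟩ := Finset.mem_image.1 hw
  rw [Finset.sum_congr rfl (g := fun u => l u * Ψ u₀) fun u hu => by
    rw [hΨ.eq_of_weightOf_eq (Finset.mem_filter.1 hu).2], ← Finset.sum_mul, hc, zero_mul]

end TensorPower

/-! ### Haar twirling and Schur's lemma on symmetric tensors -/

section Twirl

variable {d : ℕ} {ι : Type*} [Fintype ι]

/-- Up to a scalar, every vector is the first column of some element of `SU(d)`. -/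
theorem exists_SU_column [NeZero d] (v : Fin d → ℂ) :
    ∃ (g : SU d) (c : ℂ), ∀ j, v j = c * (g : Matrix (Fin d) (Fin d) ℂ) j 0 := by
  by_cases hv : v = 0
  · exact ⟨1, 0, fun j => by simp [hv]⟩
  have hd : d ≠ 0 := NeZero.ne d
  let x : EuclideanSpace ℂ (Fin d) := WithLp.toLp 2 v
  have hx : ‖x‖ ≠ 0 := norm_ne_zero_iff.2 fun h => hv (by
    simpa [x] using h)
  have hy : ‖((‖x‖⁻¹ : ℝ) : ℂ) • x‖ = 1 := by
    rw [norm_smul, Complex.norm_real, norm_inv, norm_norm, inv_mul_cancel₀ hx]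
  obtain ⟨b, hb⟩ := Orthonormal.exists_orthonormalBasis_extension_of_card_eq (𝕜 := ℂ)
    (E := EuclideanSpace ℂ (Fin d)) (ι := Fin d) (by simp)
    (v := fun _ => ((‖x‖⁻¹ : ℝ) : ℂ) • x) (s := {0})
    ⟨fun _ => hy, fun i j hij => absurd (Subsingleton.elim i j) hij⟩
  have hb0 := hb 0 rfl
  let U : Matrix (Fin d) (Fin d) ℂ :=
    (EuclideanSpace.basisFun (Fin d) ℂ).toBasis.toMatrix b
  have hU : U ∈ unitaryGroup (Fin d) ℂ :=
    (EuclideanSpace.basisFun (Fin d) ℂ).toMatrix_orthonormalBasis_mem_unitary b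
  have hU0 : ∀ j, U j 0 = ((‖x‖⁻¹ : ℝ) : ℂ) * v j := fun j => by
    simp [U, Module.Basis.toMatrix_apply, hb0, x]
  have hdet : star U.det * U.det = 1 := (det_of_mem_unitary hU).1
  obtain ⟨z, hz⟩ := IsAlgClosed.exists_pow_nat_eq (star U.det) (Nat.pos_of_ne_zero hd)
  have hdn : ‖U.det‖ = 1 := by
    have := congrArg norm hdet
    rw [norm_mul, norm_star, norm_one] at this
    nlinarith [norm_nonneg U.det]
  have hzn : ‖z‖ = 1 := by
    have : ‖z‖ ^ d = 1 := by rw [← norm_pow, hz, norm_star, hdn]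
    exact (pow_eq_one_iff_of_nonneg (norm_nonneg z) hd).1 this
  have hzz : star z * z = 1 := by
    have := Complex.conj_mul' z
    rw [hzn] at this
    simpa using this
  have hz0 : z ≠ 0 := fun h => by simp [h] at hzn
  refine ⟨⟨z • U, mem_specialUnitaryGroup_iff.2 ⟨mem_unitaryGroup_iff'.2 ?_, ?_⟩⟩,
    (‖x‖ : ℂ) * z⁻¹, fun j => ?_⟩
  · rw [star_smul, smul_mul_smul_comm, hzz, mem_unitaryGroup_iff'.1 hU, one_smul]
  · rw [det_smul, Fintype.card_fin, hz, hdet]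
  · have hx' : (‖x‖ : ℂ) ≠ 0 := Complex.ofReal_ne_zero.2 hx
    simp only [Matrix.smul_apply, smul_eq_mul, hU0, Complex.ofReal_inv]
    field_simp

/-- The average over `SU(d)` of the conjugates of a diagonal operator by `g^{⊗ι}`. -/
noncomputable def twirl [DecidableEq ι] (R : (ι → Fin d) → ℂ) : Matrix (ι → Fin d) (ι → Fin d) ℂ :=
  average fun g => kroneckerPower ι g.1 * diagonal R * (kroneckerPower ι g.1)ᴴ

theorem continuous_twirl_integrand [DecidableEq ι] (R : (ι → Fin d) → ℂ) :
    Continuous fun g : SU d => kroneckerPower ι g.1 * diagonal R * (kroneckerPower ι g.1)ᴴ :=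
  (continuous_kroneckerPower.matrix_mul continuous_const).matrix_mul
    continuous_kroneckerPower.matrix_conjTranspose

/-- Left invariance of Haar measure absorbs conjugation by h^{⊗ι}. -/
theorem kroneckerPower_mul_twirl [DecidableEq ι] (R : (ι → Fin d) → ℂ) (h : SU d) :
    kroneckerPower ι h.1 * twirl R = twirl R * kroneckerPower ι h.1 := by
  have key : kroneckerPower ι h.1 * twirl R * (kroneckerPower ι h.1)ᴴ = twirl R := by
    rw [twirl, mul_average _ (continuous_twirl_integrand R), average_mul]
    · rw [← average_mul_left h fun g =>
        kroneckerPower ι g.1 * diagonal R * (kroneckerPower ι g.1)ᴴ]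
      congr 1
      funext g
      rw [Submonoid.coe_mul, kroneckerPower_mul, conjTranspose_mul]
      simp only [Matrix.mul_assoc]
    · exact continuous_const.matrix_mul (continuous_twirl_integrand R)
  calc kroneckerPower ι h.1 * twirl R
      = kroneckerPower ι h.1 * twirl R * ((kroneckerPower ι h.1)ᴴ * kroneckerPower ι h.1) := by
        rw [kroneckerPower_conjTranspose_mul, Matrix.mul_one]
    _ = twirl R * kroneckerPower ι h.1 := by rw [← Matrix.mul_assoc, key]

/-- The weight of e₀^{⊗ι} is carried by no other product basis vector, and a single element of the
diagonal torus of SU(d) detects this. -/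
theorem exists_diagonal_SU_ne [NeZero d] {u : ι → Fin d} (hu : u ≠ 0) :
    ∃ x : Fin d → ℂ, diagonal x ∈ specialUnitaryGroup (Fin d) ℂ ∧
      ∏ i, x (u i) ≠ ∏ _i : ι, x 0 := by
  obtain ⟨i₀, hi₀⟩ := Function.ne_iff.1 hu
  set j := u i₀ with hj
  have hj0 : j ≠ 0 := hi₀
  -- With z at 0, z⁻¹ at j and 1 elsewhere, the ratio of the two characters is z to an exponent
  -- between 2 and 2|ι|, which a root of order 2|ι| + 1 cannot kill.
  set N := 2 * Fintype.card ι + 1 with hN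
  obtain ⟨z, hz⟩ : ∃ z : ℂ, IsPrimitiveRoot z N :=
    ⟨_, Complex.isPrimitiveRoot_exp N (by omega)⟩
  have hzn : ‖z‖ = 1 := hz.norm'_eq_one (by omega)
  have hz0 : z ≠ 0 := hz.ne_zero (by omega)
  let x : Fin d → ℂ := fun a => if a = 0 then z else if a = j then z⁻¹ else 1
  have hxn : ∀ a, ‖x a‖ = 1 := fun a => by
    simp only [x]; split_ifs <;> simp [hzn]
  refine ⟨x, mem_specialUnitaryGroup_iff.2 ⟨mem_unitaryGroup_iff.2 ?_, ?_⟩, fun h => ?_⟩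
  · rw [star_eq_conjTranspose, diagonal_conjTranspose, diagonal_mul_diagonal, ← diagonal_one]
    congr 1
    funext a
    have := Complex.mul_conj' (x a)
    rw [hxn a] at this
    simpa using this
  · rw [det_diagonal, ← Finset.prod_subset (Finset.subset_univ {0, j}), Finset.prod_pair hj0.symm]
    · simp [x, hj0, hz0]
    · intro a _ ha
      simp only [Finset.mem_insert, Finset.mem_singleton, not_or] at ha
      simp [x, ha.1, ha.2]
  · have h1 : ∏ i, (x 0 * (x (u i))⁻¹) = 1 := by
      rw [Finset.prod_mul_distrib, Finset.prod_inv_distrib, ← h, mul_inv_cancel₀]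
      exact Finset.prod_ne_zero_iff.2 fun i _ => norm_ne_zero_iff.1 (by rw [hxn]; exact one_ne_zero)
    let e : ι → ℕ := fun i => if u i = 0 then 0 else if u i = j then 2 else 1
    have h2 : ∀ i, x 0 * (x (u i))⁻¹ = z ^ e i := fun i => by
      simp only [x, e]
      split_ifs <;> simp_all [sq]
    simp only [h2, Finset.prod_pow_eq_pow_sum] at h1
    have h3 := hz.dvd_of_pow_eq_one _ h1
    have h4 : ∑ i, e i ≤ ∑ _i : ι, 2 := Finset.sum_le_sum fun i _ => by
      simp only [e]; split_ifs <;> omega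
    have h5 : e i₀ ≤ ∑ i, e i := Finset.single_le_sum (fun i _ => Nat.zero_le _) (Finset.mem_univ i₀)
    have h6 : e i₀ = 2 := by simp [e, ← hj, hj0]
    have h7 := Nat.le_of_dvd (by omega) h3
    simp only [Finset.sum_const, Finset.card_univ, smul_eq_mul] at h4
    omega

theorem twirl_apply_zero_of_ne [DecidableEq ι] [NeZero d] (R : (ι → Fin d) → ℂ) {u : ι → Fin d} (hu : u ≠ 0) :
    twirl R u 0 = 0 := by
  obtain ⟨x, hx, hne⟩ := exists_diagonal_SU_ne hu
  have h := congrFun (congrFun (kroneckerPower_mul_twirl R ⟨_, hx⟩) u) 0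
  simp only [kroneckerPower_diagonal, diagonal_mul, mul_diagonal, Pi.zero_apply] at h
  by_contra h0
  exact hne (mul_right_cancel₀ h0 (h.trans (mul_comm _ _)))

/-- The twirl commutes with the diagonal torus, so e₀^{⊗ι}, alone in its weight, is an eigenvector.
Commuting with all g^{⊗ι}, the twirl has the same eigenvalue on every (g e₀)^{⊗ι}. Up to scalars
these are all the powers v^{⊗ι}, which determine a linear form on symmetric tensors. -/
theorem twirl_mulVec [DecidableEq ι] [NeZero d] (R : (ι → Fin d) → ℂ) {Ψ : (ι → Fin d) → ℂ}
    (hΨ : IsSymmTensor Ψ) : twirl R *ᵥ Ψ = twirl R 0 0 • Ψ := by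
  have hcol : ∀ u, twirl R u 0 = twirl R 0 0 * (1 : Matrix (ι → Fin d) (ι → Fin d) ℂ) u 0 := by
    intro u
    by_cases hu : u = 0
    · subst hu; simp
    · rw [twirl_apply_zero_of_ne R hu, one_apply_ne hu, mul_zero]
  have hpow : ∀ (g : SU d) (u : ι → Fin d),
      ∑ w, twirl R u w * kroneckerPower ι g.1 w 0 = twirl R 0 0 * kroneckerPower ι g.1 u 0 := by
    intro g u
    have h := congrFun (congrFun (kroneckerPower_mul_twirl R g) u) 0
    rw [mul_apply, mul_apply] at h
    rw [← h]
    have h1 : ∀ w, kroneckerPower ι g.1 u w * twirl R w 0 =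
        twirl R 0 0 * (kroneckerPower ι g.1 u w * (1 : Matrix (ι → Fin d) (ι → Fin d) ℂ) w 0) :=
      fun w => by rw [hcol]; ring
    rw [Finset.sum_congr rfl fun w _ => h1 w, ← Finset.mul_sum, ← mul_apply, Matrix.mul_one]
  ext u
  have := hΨ.dotProduct_eq_zero (fun w => twirl R u w - if w = u then twirl R 0 0 else 0) fun v => by
    obtain ⟨g, c, hc⟩ := exists_SU_column v
    have hv : ∀ w : ι → Fin d, ∏ i, v (w i) = c ^ Fintype.card ι * kroneckerPower ι g.1 w 0 := by
      intro w
      rw [Finset.prod_congr rfl fun i _ => hc (w i), Finset.prod_mul_distrib, Finset.prod_const,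
        Finset.card_univ]
      rfl
    calc ∑ w, (twirl R u w - if w = u then twirl R 0 0 else 0) * ∏ i, v (w i)
        = c ^ Fintype.card ι * (∑ w, twirl R u w * kroneckerPower ι g.1 w 0 -
            ∑ w, (if w = u then twirl R 0 0 else 0) * kroneckerPower ι g.1 w 0) := by
          rw [← Finset.sum_sub_distrib, Finset.mul_sum]
          exact Finset.sum_congr rfl fun w _ => by rw [hv]; ring
      _ = 0 := by
          rw [hpow]
          simp only [ite_mul, zero_mul, Finset.sum_ite_eq', Finset.mem_univ, if_true, sub_self,
            mul_zero]
  simp only [sub_mul, Finset.sum_sub_distrib, ite_mul, zero_mul, Finset.sum_ite_eq',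
    Finset.mem_univ, if_true] at this
  exact sub_eq_zero.1 this

theorem twirl_zero_zero [DecidableEq ι] [NeZero d] (R : (ι → Fin d) → ℂ) :
    twirl R 0 0 = ∫ g : SU d, ∑ w, R w * ∏ i, ((‖g.1 0 (w i)‖ ^ 2 : ℝ) : ℂ) ∂haarSU d := by
  simp only [twirl, average, of_apply]
  congr 1
  funext g
  rw [mul_apply]
  refine Finset.sum_congr rfl fun w _ => ?_
  rw [mul_diagonal, conjTranspose_apply, kroneckerPower_apply]
  simp only [Pi.zero_apply, Complex.ofReal_pow, ← Complex.mul_conj', Finset.prod_mul_distrib, star_prod,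
    RCLike.star_def]
  ring

end Twirl

/-! ### The dimension of the symmetric subspace -/

section Dimension

variable {d n : ℕ}

theorem mem_symSubspace {ψ : TensorSpace d n} : ψ ∈ symSubspace d n ↔ IsSymmTensor ψ.ofLp := Iff.rfl

/-- The multiset of the entries of a tuple. -/
def symOf (u : Fin n → Fin d) : Sym (Fin d) n :=
  ⟨Finset.univ.val.map u, by simp⟩

theorem weightOf_eq_of_symOf_eq {u w : Fin n → Fin d} (h : symOf u = symOf w) :
    weightOf u = weightOf w := by
  funext a
  have := congrArg (fun s => Multiset.count a s) (congrArg Subtype.val h)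
  simp only [symOf, Multiset.count_map] at this
  simpa only [weightOf, Finset.card_def, Finset.filter_val, eq_comm] using this

theorem symOf_comp_perm (u : Fin n → Fin d) (π : Equiv.Perm (Fin n)) :
    symOf (u ∘ π) = symOf u := by
  refine Subtype.ext ?_
  simp only [symOf, ← Multiset.map_map]
  congr 1
  exact congrArg Finset.val (Finset.map_univ_equiv π)

theorem symOf_surjective : Function.Surjective (symOf : (Fin n → Fin d) → Sym (Fin d) n) := by
  rintro ⟨s, hs⟩
  induction s using Quotient.inductionOn with
  | h l =>
    obtain rfl : l.length = n := hs
    refine ⟨l.get, Subtype.ext ?_⟩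
    simp [symOf]

/-- Symmetric tensors are the functions on multisets. -/
noncomputable def symSubspaceEquiv (d n : ℕ) : symSubspace d n ≃ₗ[ℂ] (Sym (Fin d) n → ℂ) where
  toFun ψ s := ψ.1 (Function.surjInv symOf_surjective s)
  invFun f := ⟨WithLp.toLp 2 fun u => f (symOf u), fun π u => by simp [symOf_comp_perm]⟩
  map_add' _ _ := rfl
  map_smul' _ _ := rfl
  left_inv ψ := by
    ext u
    exact IsSymmTensor.eq_of_weightOf_eq ψ.2
      (weightOf_eq_of_symOf_eq (Function.surjInv_eq symOf_surjective (symOf u)))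
  right_inv f := by
    funext s
    simp [Function.surjInv_eq symOf_surjective s]

theorem dimSym_eq_choose (d n : ℕ) : dimSym d n = ((d + n - 1).choose n : ℕ) := by
  rw [dimSym, (symSubspaceEquiv d n).finrank_eq, Module.finrank_fintype_fun_eq_card,
    Sym.card_sym_eq_choose, Fintype.card_fin]

theorem dimSym_pos [NeZero d] (n : ℕ) : 0 < dimSym d n := by
  have := NeZero.pos d
  rw [dimSym_eq_choose]
  exact_mod_cast Nat.choose_pos (by omega)

end Dimension

/-! ### Moments of |g₀₀|² under Haar measure -/

section Moments

variable {d n : ℕ}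

/-- The moment `∫ t ^ a (1 - t) ^ i` of `t = |g₀₀|²` over `SU(d)`. -/
noncomputable def moment (d : ℕ) [NeZero d] (a i : ℕ) : ℝ :=
  ∫ g : SU d, (‖g.1 0 0‖ ^ 2) ^ a * (1 - ‖g.1 0 0‖ ^ 2) ^ i ∂haarSU d

theorem continuous_norm_entry (i j : Fin d) : Continuous fun g : SU d => ‖g.1 i j‖ ^ 2 :=
  (continuous_subtype_val.matrix_elem i j).norm.pow 2

theorem moment_succ [NeZero d] (a i : ℕ) : moment d a (i + 1) = moment d a i - moment d (a + 1) i := by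
  have h := continuous_norm_entry (0 : Fin d) 0
  rw [moment, moment, moment, ← integral_sub (integrable_haarSU_real (by fun_prop))
    (integrable_haarSU_real (by fun_prop))]
  congr 1
  funext g
  ring

theorem twirl_single_zero_zero [NeZero d] (n : ℕ) :
    twirl (Pi.single (0 : Fin n → Fin d) (1 : ℂ)) 0 0 = moment d n 0 := by
  rw [twirl_zero_zero, moment, ← integral_complex_ofReal]
  congr 1
  funext g
  rw [Finset.sum_eq_single 0 (fun w _ hw => by rw [Pi.single_eq_of_ne hw, zero_mul]) (by simp)]
  simp

theorem trace_twirl {ι : Type*} [Fintype ι] [DecidableEq ι] (R : (ι → Fin d) → ℂ) :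
    (twirl R).trace = ∑ w, R w := by
  rw [twirl, trace_average (integrable_entry (continuous_twirl_integrand R))]
  have h : ∀ g : SU d,
      (kroneckerPower ι g.1 * diagonal R * (kroneckerPower ι g.1)ᴴ).trace = ∑ w, R w := fun g => by
    rw [trace_mul_comm, ← Matrix.mul_assoc, kroneckerPower_conjTranspose_mul, Matrix.one_mul,
      trace_diagonal]
  simp [h]

/-- Each integrand is the projection onto (g e₀)^{⊗n}, which is a symmetric tensor. -/
theorem isSymmTensor_twirl_single_mulVec [NeZero d] (x : (Fin n → Fin d) → ℂ) :
    IsSymmTensor (twirl (Pi.single (0 : Fin n → Fin d) (1 : ℂ)) *ᵥ x) := by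
  intro π u
  have h : ∀ w, twirl (Pi.single (0 : Fin n → Fin d) (1 : ℂ)) (u ∘ π) w =
      twirl (Pi.single (0 : Fin n → Fin d) (1 : ℂ)) u w := fun w => by
    simp only [twirl, average, of_apply]
    congr 1
    funext g
    rw [mul_apply, mul_apply]
    refine Finset.sum_congr rfl fun v _ => ?_
    rw [mul_diagonal, mul_diagonal]
    by_cases hv : v = 0
    · subst hv
      congr 2
      exact Equiv.prod_comp π fun i => g.1 (u i) 0
    · simp [Pi.single_eq_of_ne hv]
  simp only [mulVec, dotProduct, h]

/-- The twirl of the projection onto e₀^{⊗n} has trace 1 and range in the symmetric subspace, where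
it is the scalar ∫ |g₀₀|^{2n}; so that scalar times the dimension is the trace. -/
theorem moment_zero_mul_dimSym [NeZero d] (n : ℕ) : moment d n 0 * dimSym d n = 1 := by
  set M := twirl (Pi.single (0 : Fin n → Fin d) (1 : ℂ)) with hM
  let f : TensorSpace d n →ₗ[ℂ] TensorSpace d n := toEuclideanLin M
  have hf : ∀ ψ, f ψ ∈ symSubspace d n := fun ψ => isSymmTensor_twirl_single_mulVec ψ.ofLp
  have hs : f.restrict (fun ψ _ => hf ψ) =
      (moment d n 0 : ℂ) • (LinearMap.id : symSubspace d n →ₗ[ℂ] symSubspace d n) := by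
    ext ψ u
    have := congrFun (twirl_mulVec (Pi.single (0 : Fin n → Fin d) (1 : ℂ)) ψ.2) u
    rw [twirl_single_zero_zero] at this
    exact this
  have h := LinearMap.trace_restrict_eq_of_forall_mem (symSubspace d n) f hf
  rw [hs, map_smul, LinearMap.trace_id] at h
  have ht : LinearMap.trace ℂ _ f = 1 := by
    rw [LinearMap.trace_eq_matrix_trace ℂ (EuclideanSpace.basisFun (Fin n → Fin d) ℂ).toBasis]
    simp only [f, toEuclideanLin_eq_toLin_orthonormal, LinearMap.toMatrix_toLin]
    rw [hM, trace_twirl]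
    simp
  rw [ht, smul_eq_mul] at h
  rw [dimSym]
  exact_mod_cast h

theorem moment_eq [NeZero d] (a i : ℕ) :
    moment d a i = ((i + d - 2).choose i : ℝ) / (((a + i).choose i : ℝ) * dimSym d (a + i)) := by
  have h0 : ∀ a, moment d a 0 = 1 / dimSym d a := fun a =>
    eq_one_div_of_mul_eq_one_left (moment_zero_mul_dimSym a)
  have hd := NeZero.pos d
  obtain rfl | ⟨e, rfl⟩ : d = 1 ∨ ∃ e, d = e + 2 := by
    rcases d with _ | _ | e
    · omega
    · exact Or.inl rfl
    · exact Or.inr ⟨e, rfl⟩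
  -- For d = 1 all positive powers of 1 - |g₀₀|² integrate to 0. The formula agrees because
  -- truncated subtraction turns its binomial into (i - 1 choose i) = 0 for i ≥ 1, and into 1 for i
  -- = 0.
  · have h1 : ∀ i a, moment 1 a (i + 1) = 0 := by
      intro i
      induction i with
      | zero => intro a; rw [moment_succ, h0, h0]; simp [dimSym_eq_choose]
      | succ i ih => intro a; rw [moment_succ, ih, ih, sub_zero]
    rcases i with _ | i
    · rw [h0]; simp
    · rw [h1]
      simp
  -- In factorial form this is a Beta integral, and the difference recursion in i becomes a field
  -- identity.
  · have key : ∀ i a, moment (e + 2) a i =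
        ((i + e).factorial * a.factorial * (e + 1) : ℝ) / ((a + i + e + 1).factorial : ℝ) := by
      intro i
      induction i with
      | zero =>
        intro a
        rw [h0, dimSym_eq_choose, show e + 2 + a - 1 = a + (e + 1) by omega,
          Nat.cast_add_choose, zero_add, Nat.factorial_succ e]
        have := Nat.factorial_pos (a + (e + 1))
        push_cast
        field_simp
        rfl
      | succ i ih =>
        intro a
        rw [moment_succ, ih, ih, show i + 1 + e = (i + e) + 1 by omega,
          show a + 1 + i + e + 1 = (a + i + e + 1) + 1 by omega,
          show a + (i + 1) + e + 1 = (a + i + e + 1) + 1 by omega, Nat.factorial_succ (i + e),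
          Nat.factorial_succ (a + i + e + 1), Nat.factorial_succ a]
        push_cast
        field_simp
        ring
    rw [key, dimSym_eq_choose, show i + (e + 2) - 2 = i + e by omega,
      show e + 2 + (a + i) - 1 = (a + i) + (e + 1) by omega, ← Nat.choose_symm_add (a := a),
      Nat.cast_add_choose, Nat.cast_add_choose, Nat.cast_add_choose, Nat.factorial_succ e]
    push_cast
    field_simp
    rfl

end Moments

/-! ### The trace norm of a difference of positive matrices -/

section TraceNorm

variable {ι : Type*} [Fintype ι] [DecidableEq ι]

theorem traceNorm_eq_sum_abs_eigenvalues {A : Matrix ι ι ℂ} (hA : A.IsHermitian) :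
    traceNorm A = (1 / 2) * ∑ i, |hA.eigenvalues i| := by
  have hB := isHermitian_conjTranspose_mul_self A
  -- For Hermitian A this product is A², so its eigenvalue multiset, read off the characteristic
  -- polynomial, consists of the squares of those of A.
  have h1 : Aᴴ * A = cfc (fun x : ℝ => x ^ 2) A := by
    have h := cfc_pow_id (R := ℝ) A 2 hA.isSelfAdjoint
    rw [sq] at h
    rw [hA.eq]
    exact h.symm
  have h2 : (Aᴴ * A).charpoly.roots =
      Multiset.map (fun i => ((hA.eigenvalues i ^ 2 : ℝ) : ℂ)) Finset.univ.val := by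
    rw [h1, hA.charpoly_cfc_eq, Polynomial.roots_prod]
    · simp only [Polynomial.roots_X_sub_C, Multiset.bind_singleton]
      rfl
    · exact Finset.prod_ne_zero_iff.2 fun i _ => Polynomial.X_sub_C_ne_zero _
  rw [hB.roots_charpoly_eq_eigenvalues] at h2
  have h3 := congrArg (fun s => (s.map fun z : ℂ => √z.re).sum) h2
  simp only [Multiset.map_map, Function.comp_def, RCLike.ofReal_eq_complex_ofReal,
    Complex.ofReal_re, Real.sqrt_sq_eq_abs] at h3
  rw [traceNorm]
  congr 1

theorem sum_re_eigenvectorBasis {A : Matrix ι ι ℂ} (hA : A.IsHermitian) (X : Matrix ι ι ℂ) :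
    ∑ i, (star (hA.eigenvectorBasis i).ofLp ⬝ᵥ X *ᵥ (hA.eigenvectorBasis i).ofLp).re =
      X.trace.re := by
  have h : (star (hA.eigenvectorUnitary : Matrix ι ι ℂ) * (X * hA.eigenvectorUnitary)).trace =
      X.trace := by
    rw [trace_mul_comm, Matrix.mul_assoc, Unitary.mul_star_self_of_mem hA.eigenvectorUnitary.2,
      Matrix.mul_one]
  rw [← h, trace, Complex.re_sum]
  refine Finset.sum_congr rfl fun i _ => ?_
  simp only [diag, mul_apply, dotProduct, mulVec, star_apply, Pi.star_apply,
    IsHermitian.eigenvectorUnitary_apply]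

/-- In an eigenbasis of X - Y each eigenvalue is a difference of two nonnegative diagonal entries,
hence at most their sum in absolute value. -/
theorem traceNorm_sub_le {X Y : Matrix ι ι ℂ} (hX : X.PosSemidef) (hY : Y.PosSemidef) :
    traceNorm (X - Y) ≤ (1 / 2) * (X.trace.re + Y.trace.re) := by
  have hA : (X - Y).IsHermitian := hX.isHermitian.sub hY.isHermitian
  rw [traceNorm_eq_sum_abs_eigenvalues hA, ← sum_re_eigenvectorBasis hA X,
    ← sum_re_eigenvectorBasis hA Y, ← Finset.sum_add_distrib]
  refine mul_le_mul_of_nonneg_left (Finset.sum_le_sum fun i _ => ?_) (by norm_num)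
  rw [hA.eigenvalues_eq, sub_mulVec, dotProduct_sub, map_sub]
  have h1 := hX.re_dotProduct_nonneg (hA.eigenvectorBasis i).ofLp
  have h2 := hY.re_dotProduct_nonneg (hA.eigenvectorBasis i).ofLp
  simp only [RCLike.re_eq_complex_re] at h1 h2 ⊢
  exact abs_sub_le_of_nonneg_of_le h1 (by linarith) h2 (by linarith)

end TraceNorm

/-! ### The error term and its estimate -/

section ErrorBound

variable {d n k r : ℕ}

/-- Integrate t^(n-k) ((1 - t) + t)^k, expanded by the binomial theorem, with t = |g₀₀|². -/
theorem sum_choose_mul_moment [NeZero d] (hkn : k ≤ n) :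
    ∑ i ∈ Finset.range (k + 1), (k.choose i : ℝ) * moment d (n - i) i = moment d (n - k) 0 := by
  have h := continuous_norm_entry (0 : Fin d) 0
  simp only [moment, ← integral_const_mul]
  rw [← integral_finsetSum _ fun i _ => integrable_haarSU_real (by fun_prop)]
  congr 1
  funext g
  set t := ‖g.1 0 0‖ ^ 2
  have ht : t ^ (n - k) * (1 - t) ^ 0 = t ^ (n - k) * ((1 - t) + t) ^ k := by
    rw [sub_add_cancel, one_pow, pow_zero]
  rw [ht, add_pow, Finset.mul_sum]
  refine Finset.sum_congr rfl fun i hi => ?_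
  have hi := Finset.mem_range.1 hi
  rw [show n - i = (n - k) + (k - i) by omega, pow_add]
  ring

/-- The error `ε_{n,k,r,d}` in terms of the moments of `|g₀₀|²`. -/
theorem errorBound_eq [NeZero d] (hrk : r ≤ k) (hkn : k ≤ n) :
    errorBound n k r d = 2 * (1 - dimSym d (n - k) *
      ∑ i ∈ Finset.range (r + 1), (k.choose i : ℝ) * moment d (n - i) i) := by
  have h0 := sum_choose_mul_moment (d := d) hkn
  rw [← Finset.sum_range_add_sum_Ico _ (show r + 1 ≤ k + 1 by omega)] at h0
  have h1 := moment_zero_mul_dimSym (d := d) (n - k)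
  have hn := (dimSym_pos (d := d) n).ne'
  have h2 : ∑ i ∈ Finset.Icc (r + 1) k, ((k.choose i : ℝ) / (n.choose i : ℝ)) *
      ((i + d - 2).choose i : ℝ) =
      dimSym d n * ∑ i ∈ Finset.Ico (r + 1) (k + 1), (k.choose i : ℝ) * moment d (n - i) i := by
    rw [Finset.mul_sum]
    refine Finset.sum_congr rfl fun i hi => ?_
    have hi := Finset.mem_Ico.1 hi
    have hc : (n.choose i : ℝ) ≠ 0 := by exact_mod_cast (Nat.choose_pos (by omega)).ne'
    rw [moment_eq, Nat.sub_add_cancel (by omega : i ≤ n)]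
    field_simp
  rw [errorBound, h2, ← h1, ← h0]
  field_simp
  ring

/-- Factor by factor, (k - j)/(n - j) ≤ k/n. -/
theorem choose_mul_pow_le (hkn : k ≤ n) (i : ℕ) : k.choose i * n ^ i ≤ n.choose i * k ^ i := by
  have h : k.descFactorial i * n ^ i ≤ n.descFactorial i * k ^ i := by
    induction i with
    | zero => simp
    | succ i ih =>
      have h1 : (k - i) * n ≤ (n - i) * k := by
        rw [Nat.sub_mul, Nat.sub_mul, mul_comm n k]
        exact Nat.sub_le_sub_left (Nat.mul_le_mul_left i hkn) _
      calc k.descFactorial (i + 1) * n ^ (i + 1)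
          = ((k - i) * n) * (k.descFactorial i * n ^ i) := by
            rw [Nat.descFactorial_succ, pow_succ]; ring
        _ ≤ ((n - i) * k) * (n.descFactorial i * k ^ i) := Nat.mul_le_mul h1 ih
        _ = n.descFactorial (i + 1) * k ^ (i + 1) := by
            rw [Nat.descFactorial_succ, pow_succ]; ring
  rw [Nat.descFactorial_eq_factorial_mul_choose, Nat.descFactorial_eq_factorial_mul_choose,
    mul_assoc, mul_assoc] at h
  exact Nat.le_of_mul_le_mul_left h i.factorial_pos

/-- Up to the common factor (d - 1)!, each dimension is a rising factorial with d - 1 factors. Since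
d ≤ N, the factors in the numerator are at most 2N; those in the denominator exceed n. -/
theorem dimSym_div_dimSym_le {e N : ℕ} (hN : e + 2 ≤ N) (hn : N ≤ n) :
    dimSym (e + 2) N / dimSym (e + 2) n ≤ (2 * (N : ℝ) / n) ^ (e + 1) := by
  have hdim : ∀ a : ℕ, ((e + 1).factorial : ℝ) * dimSym (e + 2) a = ((a + 1).ascFactorial (e + 1) : ℕ) := by
    intro a
    rw [dimSym_eq_choose, Nat.ascFactorial_eq_factorial_mul_choose,
      show e + 2 + a - 1 = a + (e + 1) by omega, Nat.choose_symm_add]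
    push_cast
    ring
  have h1 : ((N + 1).ascFactorial (e + 1) : ℝ) ≤ (2 * (N : ℝ)) ^ (e + 1) := by
    have := Nat.ascFactorial_le_pow_add N (e + 1)
    have h2 : (N + (e + 1)) ^ (e + 1) ≤ (2 * N) ^ (e + 1) := Nat.pow_le_pow_left (by omega) _
    exact_mod_cast this.trans h2
  have h2 : (n : ℝ) ^ (e + 1) ≤ ((n + 1).ascFactorial (e + 1) : ℝ) := by
    have := Nat.pow_succ_le_ascFactorial (n + 1) (e + 1)
    have h3 : n ^ (e + 1) ≤ (n + 1) ^ (e + 1) := Nat.pow_le_pow_left (by omega) _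
    exact_mod_cast h3.trans this
  have hf : ((e + 1).factorial : ℝ) ≠ 0 := by exact_mod_cast (e + 1).factorial_ne_zero
  have hn0 : (0 : ℝ) < n := by exact_mod_cast (by omega : 0 < n)
  rw [← mul_div_mul_left _ _ hf, hdim, hdim, div_pow]
  exact div_le_div₀ (by positivity) h1 (by positivity) h2

theorem sum_choose_div_choose_le (hk : k < n) :
    ∑ i ∈ Finset.Icc (r + 1) k, (k.choose i : ℝ) / (n.choose i : ℝ) ≤
      ((k : ℝ) / n) ^ (r + 1) * (n / ((n : ℝ) - k)) := by
  have hn0 : (0 : ℝ) < n := by exact_mod_cast (by omega : 0 < n)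
  have hkn : (k : ℝ) < n := by exact_mod_cast hk
  have hx1 : (k : ℝ) / n < 1 := (div_lt_one hn0).2 hkn
  have hx0 : 0 ≤ (k : ℝ) / n := by positivity
  calc ∑ i ∈ Finset.Icc (r + 1) k, (k.choose i : ℝ) / (n.choose i : ℝ)
      ≤ ∑ i ∈ Finset.Ico (r + 1) (k + 1), ((k : ℝ) / n) ^ i := by
        refine Finset.sum_le_sum fun i hi => ?_
        have hi := Finset.mem_Icc.1 hi
        have hc : (0 : ℝ) < n.choose i := by exact_mod_cast Nat.choose_pos (by omega)
        rw [div_pow, div_le_div_iff₀ hc (by positivity)]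
        have := choose_mul_pow_le hk.le i
        rw [mul_comm (n.choose i)] at this
        exact_mod_cast this
    _ ≤ ((k : ℝ) / n) ^ (r + 1) / (1 - (k : ℝ) / n) := geom_sum_Ico_le_of_lt_one hx0 hx1
    _ = ((k : ℝ) / n) ^ (r + 1) * (n / ((n : ℝ) - k)) := by
        have : (n : ℝ) - k ≠ 0 := by linarith
        field_simp

theorem errorBound_le (hrk : r ≤ k) (hd : 2 ≤ d) (hdm : d ≤ min k (n - k)) :
    errorBound n k r d ≤ 2 * (Real.exp (3 * (d : ℝ)) / ((d - 2).factorial : ℝ)) *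
      ((k : ℝ) / ((n : ℝ) - (r : ℝ))) ^ (r + 1) *
      (((k : ℝ) * ((n : ℝ) - (k : ℝ))) / ((n : ℝ) - (r : ℝ))) ^ (d - 2) := by
  obtain ⟨e, rfl⟩ : ∃ e, d = e + 2 := ⟨d - 2, by omega⟩
  have hdk : e + 2 ≤ k := hdm.trans (min_le_left _ _)
  have hdN : e + 2 ≤ n - k := hdm.trans (min_le_right _ _)
  have hn0 : (0 : ℝ) < n := by exact_mod_cast (by omega : 0 < n)
  have hkn : (k : ℝ) < n := by exact_mod_cast (by omega : k < n)
  have hrk' : (r : ℝ) ≤ k := by exact_mod_cast hrk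
  have hr0 : (0 : ℝ) ≤ r := r.cast_nonneg
  have hN : ((n - k : ℕ) : ℝ) = (n : ℝ) - k := Nat.cast_sub (by omega)
  have hNpos : (0 : ℝ) < (n : ℝ) - k := by linarith
  have hrat := dimSym_div_dimSym_le hdN (Nat.sub_le n k)
  rw [hN] at hrat
  have hsum : ∑ i ∈ Finset.Icc (r + 1) k, ((k.choose i : ℝ) / (n.choose i : ℝ)) *
      ((i + (e + 2) - 2).choose i : ℝ) ≤
      ((k : ℝ) / n) ^ (r + 1) * (n / ((n : ℝ) - k)) * ((2 * (k : ℝ)) ^ e / (e.factorial : ℝ)) := by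
    refine le_trans ?_ (mul_le_mul_of_nonneg_right (sum_choose_div_choose_le (r := r)
      (by omega : k < n)) (by positivity))
    rw [Finset.sum_mul]
    refine Finset.sum_le_sum fun i hi => mul_le_mul_of_nonneg_left ?_ (by positivity)
    have hi := Finset.mem_Icc.1 hi
    rw [show i + (e + 2) - 2 = i + e by omega, Nat.choose_symm_add]
    refine (Nat.choose_le_pow_div e (i + e)).trans ?_
    have : ((i + e : ℕ) : ℝ) ≤ 2 * k := by exact_mod_cast (by omega : i + e ≤ 2 * k)
    gcongr
  have hexp : (2 : ℝ) ^ (e + 1) * 2 ^ e ≤ Real.exp (3 * ((e + 2 : ℕ) : ℝ)) := by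
    have h2 : (2 : ℝ) ≤ Real.exp 1 := by have := Real.add_one_le_exp 1; linarith
    calc (2 : ℝ) ^ (e + 1) * 2 ^ e = 2 ^ (2 * e + 1) := by rw [← pow_add]; congr 1; ring
      _ ≤ 2 ^ (3 * (e + 2)) := pow_le_pow_right₀ (by norm_num) (by omega)
      _ ≤ Real.exp 1 ^ (3 * (e + 2)) := by gcongr
      _ = Real.exp (3 * ((e + 2 : ℕ) : ℝ)) := by rw [← Real.exp_nat_mul]; push_cast; ring_nf
  have hdimnn : 0 ≤ dimSym (e + 2) (n - k) / dimSym (e + 2) n :=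
    div_nonneg (dimSym_pos _).le (dimSym_pos _).le
  have hnr : (0 : ℝ) < (n : ℝ) - r := by linarith
  rw [Nat.add_sub_cancel]
  calc errorBound n k r (e + 2)
      ≤ 2 * (2 * ((n : ℝ) - k) / n) ^ (e + 1) * (((k : ℝ) / n) ^ (r + 1) * (n / ((n : ℝ) - k)) *
          ((2 * (k : ℝ)) ^ e / (e.factorial : ℝ))) := by
        rw [errorBound]
        refine mul_le_mul (mul_le_mul_of_nonneg_left hrat (by norm_num)) hsum
          (Finset.sum_nonneg fun i _ => by positivity) (by positivity)
    -- The factor n/(n - k) from the geometric series cancels one of the d - 1 powers of (n - k)/n,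
    -- leaving the exponent d - 2.
    _ = 2 * ((2 ^ (e + 1) * 2 ^ e) / (e.factorial : ℝ)) * ((k : ℝ) / n) ^ (r + 1) *
          (((k : ℝ) * ((n : ℝ) - k)) / n) ^ e := by
        rw [div_pow, mul_pow, mul_pow, div_pow (_ * _), mul_pow, pow_succ ((n : ℝ) - k),
          pow_succ (n : ℝ) e]
        field_simp
    _ ≤ _ := by
        have h1 : (n : ℝ) - r ≤ n := by linarith
        gcongr

end ErrorBound

/-! ### Excitation number and high weights -/

section Weights

variable {d n r : ℕ} {ι : Type*} [Fintype ι]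

/-- The number of factors of a product basis vector which differ from the first basis vector. -/
def excitation [NeZero d] (u : ι → Fin d) : ℕ := (Finset.univ.filter fun i => u i ≠ 0).card

theorem weightOf_zero_add_excitation [NeZero d] (u : ι → Fin d) :
    weightOf u 0 + excitation u = Fintype.card ι := by
  rw [weightOf, excitation, Finset.card_filter_add_card_filter_not, Finset.card_univ]

theorem excitation_comp_perm [NeZero d] (u : ι → Fin d) (π : Equiv.Perm ι) :
    excitation (u ∘ π) = excitation u := by
  have h1 := weightOf_zero_add_excitation u
  have h2 := weightOf_zero_add_excitation (u ∘ π)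
  rw [weightOf_comp_perm] at h2
  omega

theorem tensorPower_eq (U : Matrix (Fin d) (Fin d) ℂ) (ψ : TensorSpace d n) :
    tensorPower n U ψ = WithLp.toLp 2 (kroneckerPower (Fin n) U *ᵥ ψ.ofLp) := rfl

theorem mem_highWeights_of_le [NeZero d] {w : Fin d → ℕ} (hw : ∑ j, w j = n) (h : n ≤ w 0 + r) :
    w ∈ highWeights d n r := by
  obtain ⟨e, rfl⟩ : ∃ e, d = e + 1 := ⟨d - 1, (Nat.sub_add_cancel (NeZero.pos d)).symm⟩
  -- The root coefficients are the tail sums of w. The largest is C 1 = n - w 0, which is at most r.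
  let C : ℕ → ℕ := fun x => ∑ j : Fin (e + 1), if x ≤ (j : ℕ) then w j else 0
  have hC1 : C 1 + w 0 = n := by
    rw [← hw, Fin.sum_univ_succ]
    simp [C, Fin.sum_univ_succ, add_comm]
  have hC : ∀ j : Fin (e + 1), C j = C (j + 1) + w j := fun j => by
    have h1 : w j = ∑ i : Fin (e + 1), if i = j then w i else 0 := by simp
    rw [h1, ← Finset.sum_add_distrib]
    refine Finset.sum_congr rfl fun i _ => ?_
    by_cases hij : i = j
    · subst hij; simp
    · have hne : (i : ℕ) ≠ j := fun h => hij (Fin.ext h)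
      simp only [hij, if_false, add_zero]
      congr 1
      exact propext ⟨fun h => by omega, fun h => by omega⟩
  have hCtop : C (e + 1) = 0 := Finset.sum_eq_zero fun j _ => if_neg (by omega)
  have hCle : ∀ x, C (x + 1) ≤ C 1 := fun x => Finset.sum_le_sum fun j _ => by
    split_ifs <;> omega
  refine ⟨hw, fun i => (C (i + 1) : ℤ), fun j => ?_, fun i => ?_⟩
  · have hs : ∀ i : Fin (e + 1 - 1), (C (i + 1) : ℤ) * simpleRoot (e + 1) i j =
        (if (j : ℕ) = i then (C (i + 1) : ℤ) else 0) -
          if (j : ℕ) = i + 1 then (C (i + 1) : ℤ) else 0 := fun i => by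
      simp only [simpleRoot]
      by_cases h1 : (j : ℕ) = i
      · simp [h1]
      · by_cases h2 : (j : ℕ) = i + 1 <;> simp [h1, h2]
    rw [Finset.sum_congr rfl fun i _ => hs i, Fin.sum_univ_eq_sum_range (fun i =>
        (if (j : ℕ) = i then (C (i + 1) : ℤ) else 0) -
          if (j : ℕ) = i + 1 then (C (i + 1) : ℤ) else 0), Finset.sum_sub_distrib,
      Finset.sum_ite_eq, Nat.add_sub_cancel]
    have h1 : (if (j : ℕ) ∈ Finset.range e then (C (j + 1) : ℤ) else 0) = C (j + 1) := by
      split_ifs with hj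
      · rfl
      · have hj : (j : ℕ) = e := by
          have := j.2
          rw [Finset.mem_range] at hj
          omega
        rw [hj, hCtop, Nat.cast_zero]
    rw [h1]
    have hCj := hC j
    rcases hj : (j : ℕ) with _ | x
    · have hj0 : j = 0 := Fin.ext hj
      subst hj0
      simp only [highestWeight, Fin.val_zero, if_true, zero_add]
      rw [Finset.sum_eq_zero fun i _ => if_neg (by omega)]
      omega
    · have hx : x < e := by have := j.2; omega
      simp only [highestWeight, hj, Nat.add_right_cancel_iff, Finset.sum_ite_eq, Finset.mem_range, hx, if_true,
        Nat.add_eq_zero_iff, one_ne_zero, and_false, if_false]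
      rw [hj] at hCj
      omega
  · rw [abs_of_nonneg (Int.natCast_nonneg _)]
    have := hCle i
    exact_mod_cast (by omega : C (i + 1) ≤ r)

theorem mem_weightSpace_of_support {φ : TensorSpace d n} (hφ : φ ∈ symSubspace d n) (w : Fin d → ℕ) :
    WithLp.toLp 2 (fun u => if weightOf u = w then φ u else 0) ∈ weightSpace d n w := by
  refine ⟨fun π u => ?_, fun h _ => ?_⟩
  · simp only [weightOf_comp_perm]
    congr 1
    exact hφ π u
  · ext u
    rw [tensorPower_eq, kroneckerPower_diagonal]
    simp only [mulVec_diagonal, PiLp.smul_apply, smul_eq_mul]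
    split_ifs with hu
    · rw [prod_eq_prod_pow_weightOf, hu]
    · simp

theorem mem_highWeightSpace_of_excitation_le [NeZero d] {φ : TensorSpace d n}
    (hφ : φ ∈ symSubspace d n) (h : ∀ u, r < excitation u → φ u = 0) :
    φ ∈ highWeightSpace d n r := by
  classical
  have hsum : φ = ∑ w ∈ Finset.univ.image (weightOf : (Fin n → Fin d) → _),
      WithLp.toLp 2 (fun u => if weightOf u = w then φ u else 0) := by
    ext u
    rw [WithLp.ofLp_sum, Finset.sum_apply]
    simp
  rw [hsum]
  refine Submodule.sum_mem _ fun w hw => ?_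
  obtain ⟨u₀, -, rfl⟩ := Finset.mem_image.1 hw
  have h0 := weightOf_zero_add_excitation u₀
  rw [Fintype.card_fin] at h0
  by_cases hr : excitation u₀ ≤ r
  · have hm : weightOf u₀ ∈ highWeights d n r :=
      mem_highWeights_of_le (by rw [sum_weightOf, Fintype.card_fin]) (by omega)
    exact Submodule.mem_iSup_of_mem _ (Submodule.mem_iSup_of_mem hm (mem_weightSpace_of_support hφ _))
  · have hz : (fun u => if weightOf u = weightOf u₀ then φ u else 0) = 0 := by
      funext u
      split_ifs with hu
      · refine h u ?_
        have h1 := weightOf_zero_add_excitation u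
        rw [Fintype.card_fin, hu] at h1
        omega
      · rfl
    rw [hz]
    exact Submodule.zero_mem _

end Weights

/-! ### Contraction with coherent states and the averaged identity -/

section Core

set_option linter.unusedSectionVars false

variable {d : ℕ} {ι κ τ : Type*} [Fintype ι] [Fintype κ] [Fintype τ]

theorem sum_sumArrow {M : Type*} [AddCommMonoid M] [DecidableEq κ] [DecidableEq τ]
    [DecidableEq (κ ⊕ τ)] (F : (κ ⊕ τ → Fin d) → M) :
    ∑ w, F w = ∑ u : κ → Fin d, ∑ t : τ → Fin d, F (Sum.elim u t) := by
  rw [← (Equiv.sumArrowEquivProdArrow κ τ (Fin d)).symm.sum_comp, Fintype.sum_prod_type]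
  rfl

theorem kroneckerPower_sumElim (U : Matrix (Fin d) (Fin d) ℂ) (u v : κ → Fin d) (t s : τ → Fin d) :
    kroneckerPower (κ ⊕ τ) U (Sum.elim u t) (Sum.elim v s) =
      kroneckerPower κ U u v * kroneckerPower τ U t s := by
  simp [kroneckerPower_apply, Fintype.prod_sum_type]

theorem kroneckerPower_mulVec_dotProduct_star [DecidableEq ι] (g : SU d) (x y : (ι → Fin d) → ℂ) :
    (kroneckerPower ι g.1 *ᵥ x) ⬝ᵥ star (kroneckerPower ι g.1 *ᵥ y) = x ⬝ᵥ star y := by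
  rw [star_mulVec, dotProduct_comm, ← dotProduct_mulVec, mulVec_mulVec,
    kroneckerPower_conjTranspose_mul, one_mulVec, dotProduct_comm]

theorem dotProduct_star_self_eq {α : Type*} [Fintype α] (x : α → ℂ) :
    x ⬝ᵥ star x = ((‖WithLp.toLp 2 x‖ ^ 2 : ℝ) : ℂ) := by
  rw [EuclideanSpace.norm_sq_eq, Complex.ofReal_sum]
  refine Finset.sum_congr rfl fun i _ => ?_
  rw [Complex.ofReal_pow]
  exact Complex.mul_conj' (x i)

/-- The partial inner product of a tensor with `(g e₀)^{⊗τ}`. -/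
def coherentAmplitude [DecidableEq τ] [NeZero d] (Φ : (κ ⊕ τ → Fin d) → ℂ) (g : SU d) (u : κ → Fin d) : ℂ :=
  ∑ t : τ → Fin d, star (kroneckerPower τ g.1 t 0) * Φ (Sum.elim u t)

/-- The partial inner product with `(g e₀)^{⊗τ}`, rotated back by `g`. -/
def rotatedAmplitude [DecidableEq κ] [DecidableEq τ] [NeZero d] (Φ : (κ ⊕ τ → Fin d) → ℂ) (g : SU d) :
    (κ → Fin d) → ℂ :=
  (kroneckerPower κ g.1)ᴴ *ᵥ coherentAmplitude Φ g

/-- The partial trace over the factors `τ` of the operator `|Φ⟩⟨Φ|`. -/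
def reducedMatrix [DecidableEq τ] (Φ : (κ ⊕ τ → Fin d) → ℂ) : Matrix (κ → Fin d) (κ → Fin d) ℂ :=
  of fun u v => ∑ t : τ → Fin d, Φ (Sum.elim u t) * star (Φ (Sum.elim v t))

variable [DecidableEq κ] [DecidableEq τ] [NeZero d]

/-- The diagonal operator on `κ ⊕ τ` with weight `p` on the `κ` factors, and the projection onto the
first basis vector on the `τ` factors. -/
def extendWeight (τ : Type*) [Fintype τ] [DecidableEq τ] (p : (κ → Fin d) → ℂ) (w : κ ⊕ τ → Fin d) : ℂ :=
  p (w ∘ Sum.inl) * (Pi.single (0 : τ → Fin d) (1 : ℂ) : (τ → Fin d) → ℂ) (w ∘ Sum.inr)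

theorem extendWeight_sumElim (p : (κ → Fin d) → ℂ) (u : κ → Fin d) (t : τ → Fin d) :
    extendWeight τ p (Sum.elim u t) = p u * (Pi.single (0 : τ → Fin d) (1 : ℂ) : (τ → Fin d) → ℂ) t := rfl

theorem kroneckerPower_mulVec_rotatedAmplitude (Φ : (κ ⊕ τ → Fin d) → ℂ) (g : SU d) :
    kroneckerPower κ g.1 *ᵥ rotatedAmplitude Φ g = coherentAmplitude Φ g := by
  rw [rotatedAmplitude, mulVec_mulVec, kroneckerPower_mul_conjTranspose, one_mulVec]

theorem conjTranspose_mulVec_sumElim (Φ : (κ ⊕ τ → Fin d) → ℂ) (g : SU d) (u : κ → Fin d) :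
    ((kroneckerPower (κ ⊕ τ) g.1)ᴴ *ᵥ Φ) (Sum.elim u 0) = rotatedAmplitude Φ g u := by
  simp only [rotatedAmplitude, coherentAmplitude, mulVec, dotProduct, conjTranspose_apply,
    sum_sumArrow, kroneckerPower_sumElim, Finset.mul_sum, star_mul']
  exact Finset.sum_congr rfl fun v _ => Finset.sum_congr rfl fun t _ => by ring

/-- The projection onto e₀^{⊗τ} collapses the τ factors, so the conjugated operator yields a product
vector whose second factor is (g e₀)^{⊗τ}. -/
theorem conjugate_mulVec_sumElim (p : (κ → Fin d) → ℂ) (Φ : (κ ⊕ τ → Fin d) → ℂ) (g : SU d)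
    (u : κ → Fin d) (t : τ → Fin d) :
    ((kroneckerPower (κ ⊕ τ) g.1 * diagonal (extendWeight τ p) * (kroneckerPower (κ ⊕ τ) g.1)ᴴ) *ᵥ Φ)
      (Sum.elim u t) =
      (kroneckerPower κ g.1 *ᵥ (p * rotatedAmplitude Φ g)) u * kroneckerPower τ g.1 t 0 := by
  rw [← mulVec_mulVec, ← mulVec_mulVec, mulVec, dotProduct, sum_sumArrow, mulVec, dotProduct,
    Finset.sum_mul]
  refine Finset.sum_congr rfl fun v _ => ?_
  rw [Finset.sum_eq_single 0 _ (by simp)]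
  · rw [mulVec_diagonal, conjTranspose_mulVec_sumElim, extendWeight_sumElim, kroneckerPower_sumElim,
      Pi.single_eq_same, Pi.mul_apply]
    ring
  · intro s _ hs
    rw [mulVec_diagonal, extendWeight_sumElim, Pi.single_eq_of_ne hs]
    ring

theorem continuous_coherentAmplitude (Φ : (κ ⊕ τ → Fin d) → ℂ) :
    Continuous (coherentAmplitude Φ) :=
  continuous_pi fun _ => continuous_finsetSum _ fun t _ =>
    (continuous_kroneckerPower.matrix_elem t 0).star.mul continuous_const

theorem continuous_rotatedAmplitude (Φ : (κ ⊕ τ → Fin d) → ℂ) :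
    Continuous (rotatedAmplitude Φ) :=
  continuous_kroneckerPower.matrix_conjTranspose.matrix_mulVec (continuous_coherentAmplitude Φ)

theorem continuous_weighted (p : (κ → Fin d) → ℂ) (Φ : (κ ⊕ τ → Fin d) → ℂ) :
    Continuous fun g => kroneckerPower κ g.1 *ᵥ (p * rotatedAmplitude Φ g) :=
  continuous_kroneckerPower.matrix_mulVec (continuous_const.mul (continuous_rotatedAmplitude Φ))

/-- Write the scalar action of the twirl on Φ in components (u, t) and contract t with the conjugate
of Φ(v, t). The factor (g e₀)^{⊗τ} then turns this conjugate into that of the coherent amplitude. -/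
theorem average_weighted (p : (κ → Fin d) → ℂ) {Φ : (κ ⊕ τ → Fin d) → ℂ} (hΦ : IsSymmTensor Φ) :
    (average fun g => vecMulVec (kroneckerPower κ g.1 *ᵥ (p * rotatedAmplitude Φ g))
      (star (coherentAmplitude Φ g))) =
      twirl (extendWeight τ p) 0 0 • reducedMatrix Φ := by
  ext u v
  have h := twirl_mulVec (extendWeight τ p) hΦ
  have hc := continuous_twirl_integrand (extendWeight τ p)
  simp only [average, of_apply, Matrix.smul_apply, reducedMatrix, smul_eq_mul, Finset.mul_sum]
  have h1 : ∀ t, twirl (extendWeight τ p) 0 0 * (Φ (Sum.elim u t) * star (Φ (Sum.elim v t))) =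
      ∫ g, ((kroneckerPower κ g.1 *ᵥ (p * rotatedAmplitude Φ g)) u * kroneckerPower τ g.1 t 0) *
        star (Φ (Sum.elim v t)) ∂haarSU d := fun t => by
    have h2 := congrFun h (Sum.elim u t)
    rw [twirl, average_mulVec _ (integrable_entry hc)] at h2
    simp only [conjugate_mulVec_sumElim] at h2
    rw [integral_mul_const, h2, Pi.smul_apply, smul_eq_mul, twirl]
    ring
  rw [Finset.sum_congr rfl fun t _ => h1 t, ← integral_finsetSum]
  · congr 1
    funext g
    rw [vecMulVec_apply, Pi.star_apply, coherentAmplitude, star_sum, Finset.mul_sum]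
    refine Finset.sum_congr rfl fun t _ => ?_
    rw [star_mul', star_star]
    ring
  · intro t _
    refine integrable_haarSU ?_
    exact (((continuous_apply u).comp (continuous_weighted p Φ)).mul
      (continuous_kroneckerPower.matrix_elem t 0)).mul continuous_const

/-- The indicator of the product basis vectors with at most `r` excitations. -/
def lowExcitation (r : ℕ) (u : κ → Fin d) : ℂ := if excitation u ≤ r then 1 else 0

/-- For nonnegative q this is a binomial distribution: independent letters drawn with law q differ
from 0 with probability 1 - q 0. The proof fibres over the set S of excited positions. -/
theorem sum_excitation_le (q : Fin d → ℝ) (hq : ∑ a, q a = 1) {r : ℕ} (hr : r ≤ Fintype.card κ) :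
    ∑ u : κ → Fin d, (if excitation u ≤ r then ∏ i, q (u i) else 0) =
      ∑ i ∈ Finset.range (r + 1), ((Fintype.card κ).choose i : ℝ) *
        (q 0 ^ (Fintype.card κ - i) * (1 - q 0) ^ i) := by
  have hfib : ∀ S : Finset κ, ∑ u : κ → Fin d with (Finset.univ.filter fun i => u i ≠ 0) = S,
      ∏ i, q (u i) = q 0 ^ (Fintype.card κ - S.card) * (1 - q 0) ^ S.card := by
    intro S
    have h1 : ∀ u : κ → Fin d, (if (Finset.univ.filter fun i => u i ≠ 0) = S then ∏ i, q (u i) else 0) =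
        ∏ i, if (u i ≠ 0 ↔ i ∈ S) then q (u i) else 0 := by
      intro u
      split_ifs with h
      · refine Finset.prod_congr rfl fun i _ => ?_
        rw [if_pos]
        rw [← h]
        simp
      · obtain ⟨i, hi⟩ : ∃ i, ¬ (u i ≠ 0 ↔ i ∈ S) := by
          by_contra! hcon
          exact h (Finset.ext fun i => by simpa using hcon i)
        exact (Finset.prod_eq_zero (Finset.mem_univ i) (if_neg hi)).symm
    have h2 : ∀ i : κ, ∑ a, (if (a ≠ 0 ↔ i ∈ S) then q a else 0) =
        if i ∈ S then 1 - q 0 else q 0 := by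
      intro i
      have h3 : 1 - q 0 = ∑ a, if a ≠ 0 then q a else 0 := by
        rw [← hq, ← Finset.sum_filter, Finset.filter_ne', ← Finset.add_sum_erase _ q (Finset.mem_univ 0)]
        ring
      by_cases hi : i ∈ S
      · simp only [hi, iff_true, if_true, h3]
      · simp [hi]
    rw [Finset.sum_filter, Finset.sum_congr rfl fun u _ => h1 u]
    rw [← Fintype.prod_sum fun (i : κ) a => if (a ≠ 0 ↔ i ∈ S) then q a else 0]
    rw [Finset.prod_congr rfl fun i _ => h2 i, Finset.prod_ite, Finset.prod_const, Finset.prod_const,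
      mul_comm]
    congr 2
    · rw [← Finset.card_compl]
      congr 1
      ext i; simp
    · congr 1
      ext i; simp
  rw [← Finset.sum_fiberwise (g := fun u : κ → Fin d => Finset.univ.filter fun i => u i ≠ 0)]
  have h4 : ∀ S : Finset κ, ∑ u : κ → Fin d with (Finset.univ.filter fun i => u i ≠ 0) = S,
      (if excitation u ≤ r then ∏ i, q (u i) else 0) =
      (fun c : ℕ => if c ≤ r then q 0 ^ (Fintype.card κ - c) * (1 - q 0) ^ c else 0) S.card := by
    intro S
    have h5 : ∀ u ∈ Finset.univ.filter fun u : κ → Fin d =>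
        (Finset.univ.filter fun i => u i ≠ 0) = S,
        (if excitation u ≤ r then ∏ i, q (u i) else 0) = if S.card ≤ r then ∏ i, q (u i) else 0 :=
      fun u hu => by rw [excitation, (Finset.mem_filter.1 hu).2]
    rw [Finset.sum_congr rfl h5]
    dsimp only
    split_ifs
    · exact hfib S
    · exact Finset.sum_const_zero
  rw [Finset.sum_congr rfl fun S _ => h4 S, ← Finset.powerset_univ,
    Finset.sum_powerset_apply_card
      (fun c : ℕ => if c ≤ r then q 0 ^ (Fintype.card κ - c) * (1 - q 0) ^ c else 0),
    Finset.card_univ, ← Finset.sum_subset (Finset.range_mono (show r + 1 ≤ Fintype.card κ + 1 by omega))]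
  · refine Finset.sum_congr rfl fun i hi => ?_
    rw [if_pos (by have := Finset.mem_range.1 hi; omega), nsmul_eq_mul]
  · intro i _ hi
    rw [if_neg (by rw [Finset.mem_range] at hi; omega), smul_zero]

theorem SU.sum_norm_sq_row (g : SU d) (i : Fin d) : ∑ a, ‖g.1 i a‖ ^ 2 = 1 := by
  have h := congrFun (congrFun (SU.mul_conjTranspose g) i) i
  rw [mul_apply, one_apply_eq] at h
  have h2 : ((∑ a, ‖g.1 i a‖ ^ 2 : ℝ) : ℂ) = 1 := by
    rw [← h, Complex.ofReal_sum]
    refine Finset.sum_congr rfl fun a _ => ?_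
    rw [Complex.ofReal_pow]
    exact (Complex.mul_conj' _).symm
  exact_mod_cast h2

/-- The squared moduli of row 0 of g sum to 1, so the integrand is a truncated binomial sum on the κ
factors times |g₀₀|^{2|τ|} from the τ factors. -/
theorem twirl_lowExcitation {r : ℕ} (hr : r ≤ Fintype.card κ) :
    twirl (extendWeight τ (lowExcitation r : (κ → Fin d) → ℂ)) 0 0 =
      ((∑ i ∈ Finset.range (r + 1), ((Fintype.card κ).choose i : ℝ) *
        moment d (Fintype.card κ + Fintype.card τ - i) i : ℝ) : ℂ) := by
  have h := continuous_norm_entry (0 : Fin d) 0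
  simp only [moment, ← integral_const_mul]
  rw [← integral_finsetSum _ fun i _ => integrable_haarSU_real (by fun_prop), twirl_zero_zero,
    ← integral_complex_ofReal]
  congr 1
  funext g
  set q : Fin d → ℝ := fun a => ‖g.1 0 a‖ ^ 2 with hq
  have h1 : ∑ w : κ ⊕ τ → Fin d, extendWeight τ (lowExcitation r : (κ → Fin d) → ℂ) w *
      ∏ i, ((q (w i) : ℝ) : ℂ) =
      (((∑ u : κ → Fin d, if excitation u ≤ r then ∏ i, q (u i) else 0) * q 0 ^ Fintype.card τ : ℝ) : ℂ) := by
    rw [sum_sumArrow, Finset.sum_mul, Complex.ofReal_sum]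
    refine Finset.sum_congr rfl fun u _ => ?_
    rw [Finset.sum_eq_single 0 _ (by simp)]
    · rw [extendWeight_sumElim, Fintype.prod_sum_type, Pi.single_eq_same, lowExcitation]
      split_ifs <;> simp [Finset.card_univ]
    · intro s _ hs
      rw [extendWeight_sumElim, Pi.single_eq_of_ne hs]
      ring
  refine h1.trans (congrArg _ ?_)
  rw [sum_excitation_le q (SU.sum_norm_sq_row g 0) hr, Finset.sum_mul]
  refine Finset.sum_congr rfl fun i hi => ?_
  have hi := Finset.mem_range.1 hi
  rw [show Fintype.card κ + Fintype.card τ - i = (Fintype.card κ - i) + Fintype.card τ by omega, pow_add]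
  ring

theorem IsSymmTensor.coherentAmplitude {Φ : (κ ⊕ τ → Fin d) → ℂ} (hΦ : IsSymmTensor Φ) (g : SU d) :
    IsSymmTensor (coherentAmplitude Φ g) := by
  intro π u
  refine Finset.sum_congr rfl fun t _ => ?_
  rw [← hΦ (Equiv.sumCongr π (Equiv.refl τ)) (Sum.elim u t)]
  congr 2
  ext i
  rcases i with i | i <;> rfl

theorem IsSymmTensor.rotatedAmplitude {Φ : (κ ⊕ τ → Fin d) → ℂ} (hΦ : IsSymmTensor Φ) (g : SU d) :
    IsSymmTensor (rotatedAmplitude Φ g) := by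
  rw [DeFinetti.rotatedAmplitude, kroneckerPower_conjTranspose]
  exact (hΦ.coherentAmplitude g).mulVec _

theorem IsSymmTensor.lowExcitation_mul {θ : (κ → Fin d) → ℂ} (hθ : IsSymmTensor θ) (r : ℕ) :
    IsSymmTensor (lowExcitation r * θ) := by
  intro π u
  rw [Pi.mul_apply, Pi.mul_apply, hθ π u, lowExcitation, lowExcitation, excitation_comp_perm]

end Core

/-! ### The approximating mixture -/

section Approximation

set_option linter.unusedSectionVars false

variable {d k m r : ℕ} [NeZero d]

theorem lowExcitation_card_mul (θ : (Fin k → Fin d) → ℂ) : lowExcitation k * θ = θ := by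
  funext u
  have := weightOf_zero_add_excitation u
  rw [Fintype.card_fin] at this
  rw [Pi.mul_apply, lowExcitation, if_pos (by omega), one_mul]

theorem proj_eq_vecMulVec (ψ : TensorSpace d k) : proj ψ = vecMulVec ψ.ofLp (star ψ.ofLp) := rfl

/-- The part of the rotated amplitude with at most `r` excitations. -/
noncomputable def lowPart (r : ℕ) (Φ : (Fin k ⊕ Fin m → Fin d) → ℂ) (g : SU d) : TensorSpace d k :=
  WithLp.toLp 2 (lowExcitation r * rotatedAmplitude Φ g)

theorem continuous_lowPart (r : ℕ) (Φ : (Fin k ⊕ Fin m → Fin d) → ℂ) :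
    Continuous (lowPart r Φ) :=
  (PiLp.continuous_toLp 2 _).comp (continuous_const.mul (continuous_rotatedAmplitude Φ))

theorem lowPart_mem {Φ : (Fin k ⊕ Fin m → Fin d) → ℂ} (hΦ : IsSymmTensor Φ) (g : SU d) :
    lowPart r Φ g ∈ highWeightSpace d k r := by
  refine mem_highWeightSpace_of_excitation_le
    (mem_symSubspace.2 ((hΦ.rotatedAmplitude g).lowExcitation_mul r)) fun u hu => ?_
  change lowExcitation r u * _ = 0
  rw [lowExcitation, if_neg (by omega), zero_mul]

theorem single_mem_highWeightSpace :
    (EuclideanSpace.single 0 1 : TensorSpace d k) ∈ highWeightSpace d k r := by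
  have h : ∀ u : Fin k → Fin d, (EuclideanSpace.single 0 1 : TensorSpace d k) u =
      if excitation u = 0 then 1 else 0 := fun u => by
    rw [PiLp.single_apply]
    congr 1
    rw [excitation, Finset.card_eq_zero, Finset.filter_eq_empty_iff, funext_iff]
    simp
  refine mem_highWeightSpace_of_excitation_le (fun π u => ?_) fun u hu => ?_
  · rw [h, h, excitation_comp_perm]
  · rw [h, if_neg (by omega)]

/-- The normalised part of the rotated amplitude with at most `r` excitations. -/
noncomputable def lowState (r : ℕ) (Φ : (Fin k ⊕ Fin m → Fin d) → ℂ) (g : SU d) : TensorSpace d k :=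
  open Classical in
  -- The default e₀^{⊗k} has no excitations, so it is admissible for every r. Where it is used the
  -- squared norm of the low part is 0, so it contributes only through the constant δ in the
  -- density.
  if lowPart r Φ g = 0 then EuclideanSpace.single 0 1
  else ((‖lowPart r Φ g‖⁻¹ : ℝ) : ℂ) • lowPart r Φ g

theorem norm_lowState (Φ : (Fin k ⊕ Fin m → Fin d) → ℂ) (g : SU d) : ‖lowState r Φ g‖ = 1 := by
  rw [lowState]
  split_ifs with h
  · simp
  · rw [norm_smul, Complex.norm_real, norm_inv, norm_norm, inv_mul_cancel₀ (norm_ne_zero_iff.2 h)]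

theorem lowState_mem {Φ : (Fin k ⊕ Fin m → Fin d) → ℂ} (hΦ : IsSymmTensor Φ) (g : SU d) :
    lowState r Φ g ∈ highWeightSpace d k r := by
  rw [lowState]
  split_ifs with h
  · exact single_mem_highWeightSpace
  · exact Submodule.smul_mem _ _ (lowPart_mem hΦ g)

theorem measurable_lowState (Φ : (Fin k ⊕ Fin m → Fin d) → ℂ) : Measurable (lowState r Φ) := by
  have h := (continuous_lowPart r Φ).measurable
  classical
  unfold lowState
  refine Measurable.ite (h (measurableSet_singleton 0)) measurable_const ?_
  exact (Complex.measurable_ofReal.comp h.norm.inv).smul h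

theorem norm_smul_lowState (Φ : (Fin k ⊕ Fin m → Fin d) → ℂ) (g : SU d) :
    (‖lowPart r Φ g‖ : ℂ) • lowState r Φ g = lowPart r Φ g := by
  rw [lowState]
  split_ifs with h
  · simp [h]
  · rw [smul_smul, Complex.ofReal_inv, mul_inv_cancel₀, one_smul]
    exact Complex.ofReal_ne_zero.2 (norm_ne_zero_iff.2 h)

/-- The operators `|χ⟩⟨χ|` for the states `χ = g^{⊗k} φ` with `φ` the normalised low part. -/
noncomputable def lowProjection (r : ℕ) (Φ : (Fin k ⊕ Fin m → Fin d) → ℂ) (g : SU d) :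
    Matrix (Fin k → Fin d) (Fin k → Fin d) ℂ :=
  proj (tensorPower k g.1 (lowState r Φ g))

theorem norm_sq_smul_lowProjection (Φ : (Fin k ⊕ Fin m → Fin d) → ℂ) (g : SU d) :
    ((‖lowPart r Φ g‖ ^ 2 : ℝ) : ℂ) • lowProjection r Φ g =
      vecMulVec (kroneckerPower (Fin k) g.1 *ᵥ (lowPart r Φ g).ofLp)
        (star (kroneckerPower (Fin k) g.1 *ᵥ (lowPart r Φ g).ofLp)) := by
  conv_rhs => rw [← norm_smul_lowState Φ g]
  rw [lowProjection, proj_eq_vecMulVec, tensorPower_eq, WithLp.ofLp_smul, mulVec_smul, star_smul,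
    smul_vecMulVec, vecMulVec_smul, smul_smul, Complex.ofReal_pow, sq, Complex.star_def,
    Complex.conj_ofReal]

theorem integrable_lowProjection (Φ : (Fin k ⊕ Fin m → Fin d) → ℂ) (u v : Fin k → Fin d) :
    Integrable (fun g => lowProjection r Φ g u v) (haarSU d) := by
  have hm : ∀ u, Measurable fun g : SU d => (tensorPower k g.1 (lowState r Φ g)) u := fun u => by
    rw [show (fun g : SU d => (tensorPower k g.1 (lowState r Φ g)) u) =
      fun g => ∑ w, kroneckerPower (Fin k) g.1 u w * lowState r Φ g w from rfl]
    refine Finset.measurable_sum _ fun w _ => ?_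
    refine (continuous_kroneckerPower.matrix_elem u w).measurable.mul ?_
    exact ((continuous_apply w).comp (PiLp.continuous_ofLp 2 _)).measurable.comp
      (measurable_lowState Φ)
  have hn : ∀ g : SU d, ‖tensorPower k g.1 (lowState r Φ g)‖ = 1 := fun g => by
    have h1 := dotProduct_star_self_eq (kroneckerPower (Fin k) g.1 *ᵥ (lowState r Φ g).ofLp)
    rw [kroneckerPower_mulVec_dotProduct_star, dotProduct_star_self_eq] at h1
    have h2 : ‖lowState r Φ g‖ ^ 2 = ‖tensorPower k g.1 (lowState r Φ g)‖ ^ 2 := by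
      exact_mod_cast h1
    rw [norm_lowState, one_pow] at h2
    exact (pow_eq_one_iff_of_nonneg (norm_nonneg _) two_ne_zero).1 h2.symm
  refine Integrable.of_bound ((hm u).mul (continuous_star.measurable.comp (hm v))).aestronglyMeasurable 1
    (Filter.Eventually.of_forall fun g => ?_)
  have hb : ∀ u, ‖(tensorPower k g.1 (lowState r Φ g)) u‖ ≤ 1 := fun u =>
    (PiLp.norm_apply_le _ u).trans (hn g).le
  change ‖(_ : ℂ) * star (_ : ℂ)‖ ≤ 1
  rw [norm_mul, norm_star]
  exact mul_le_one₀ (hb u) (norm_nonneg _) (hb v)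

theorem trace_lowProjection (Φ : (Fin k ⊕ Fin m → Fin d) → ℂ) (g : SU d) :
    (lowProjection r Φ g).trace = 1 := by
  rw [lowProjection, proj_eq_vecMulVec, trace_vecMulVec, tensorPower_eq,
    kroneckerPower_mulVec_dotProduct_star, dotProduct_star_self_eq, WithLp.toLp_ofLp, norm_lowState]
  simp

theorem posSemidef_lowProjection (Φ : (Fin k ⊕ Fin m → Fin d) → ℂ) (g : SU d) :
    (lowProjection r Φ g).PosSemidef := posSemidef_vecMulVec_self_star _

theorem reducedMatrix_isHermitian (Φ : (Fin k ⊕ Fin m → Fin d) → ℂ) :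
    (reducedMatrix Φ).IsHermitian := by
  ext u v
  simp [reducedMatrix, mul_comm]

theorem reducedMatrix_posSemidef (Φ : (Fin k ⊕ Fin m → Fin d) → ℂ) :
    (reducedMatrix Φ).PosSemidef := by
  have : reducedMatrix Φ = ∑ t, vecMulVec (fun u => Φ (Sum.elim u t))
      (star fun u => Φ (Sum.elim u t)) := by
    ext u v
    simp [reducedMatrix, Matrix.sum_apply, vecMulVec_apply]
  rw [this]
  exact posSemidef_sum _ fun t _ => posSemidef_vecMulVec_self_star _

/-- The total weight of the vectors with at most `r` excitations. -/
noncomputable def lowMass (d k m r : ℕ) [NeZero d] : ℝ :=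
  ∑ i ∈ Finset.range (r + 1), (k.choose i : ℝ) * moment d (k + m - i) i

theorem average_lowPart_coherentAmplitude {Φ : (Fin k ⊕ Fin m → Fin d) → ℂ} (hΦ : IsSymmTensor Φ)
    (hr : r ≤ k) :
    (average fun g => vecMulVec (kroneckerPower (Fin k) g.1 *ᵥ (lowPart r Φ g).ofLp)
      (star (coherentAmplitude Φ g))) = (lowMass d k m r : ℂ) • reducedMatrix Φ := by
  have h := average_weighted (lowExcitation r) hΦ
  rw [twirl_lowExcitation (by simpa using hr)] at h
  simpa only [Fintype.card_fin] using! h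

theorem lowMass_self : lowMass d k m k = (dimSym d m)⁻¹ := by
  have h := sum_choose_mul_moment (d := d) (Nat.le_add_right k m)
  rw [Nat.add_sub_cancel_left] at h
  exact h.trans (eq_inv_of_mul_eq_one_left (moment_zero_mul_dimSym m))

/-- This is the case r = k, where the excitation cutoff is vacuous. -/
theorem average_coherentAmplitude {Φ : (Fin k ⊕ Fin m → Fin d) → ℂ} (hΦ : IsSymmTensor Φ) :
    (average fun g => vecMulVec (coherentAmplitude Φ g) (star (coherentAmplitude Φ g))) =
      (((dimSym d m)⁻¹ : ℝ) : ℂ) • reducedMatrix Φ := by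
  have h := average_lowPart_coherentAmplitude hΦ le_rfl
  rw [lowMass_self] at h
  simpa only [lowPart, lowExcitation_card_mul, kroneckerPower_mulVec_rotatedAmplitude] using h

/-- Take traces in the averaged identity: truncation is an orthogonal projection, so pairing the low
part with the full amplitude gives the squared norm of the low part. -/
theorem integral_norm_lowPart_sq {Φ : (Fin k ⊕ Fin m → Fin d) → ℂ} (hΦ : IsSymmTensor Φ)
    (hr : r ≤ k) (htr : (reducedMatrix Φ).trace = 1) :
    ∫ g, ‖lowPart r Φ g‖ ^ 2 ∂haarSU d = lowMass d k m r := by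
  have h := congrArg trace (average_lowPart_coherentAmplitude hΦ hr)
  rw [trace_average (integrable_entry ?_), trace_smul, htr, smul_eq_mul, mul_one] at h
  · have h1 : ∀ g, (vecMulVec (kroneckerPower (Fin k) g.1 *ᵥ (lowPart r Φ g).ofLp)
        (star (coherentAmplitude Φ g))).trace = ((‖lowPart r Φ g‖ ^ 2 : ℝ) : ℂ) := fun g => by
      rw [trace_vecMulVec, ← kroneckerPower_mulVec_rotatedAmplitude,
        kroneckerPower_mulVec_dotProduct_star]
      refine Eq.trans ?_ (dotProduct_star_self_eq (lowPart r Φ g).ofLp)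
      refine Finset.sum_congr rfl fun u _ => ?_
      simp only [lowPart, Pi.mul_apply, Pi.star_apply, lowExcitation]
      split_ifs <;> simp
    simp only [h1] at h
    rw [integral_complex_ofReal] at h
    exact_mod_cast h
  · exact (continuous_weighted (lowExcitation r) Φ).matrix_vecMulVec
      (continuous_coherentAmplitude Φ).star

theorem exists_mixture_of_symm {Φ : (Fin k ⊕ Fin m → Fin d) → ℂ} (hΦ : IsSymmTensor Φ)
    (hr : r ≤ k) (htr : (reducedMatrix Φ).trace = 1) {δ : ℝ} (hδ : 0 ≤ δ)
    (hδ_eq : δ = 1 - dimSym d m * lowMass d k m r) :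
    ∃ (μ : Measure (SU d)) (φ : SU d → TensorSpace d k),
      IsProbabilityMeasure μ ∧ Measurable φ ∧ (∀ g, φ g ∈ highWeightSpace d k r ∧ ‖φ g‖ = 1) ∧
      traceNorm (reducedMatrix Φ -
        mixture μ fun g => tensorPower k (g : Matrix (Fin d) (Fin d) ℂ) (φ g)) ≤ 2 * δ := by
  set D := dimSym d m with hD
  have hDpos : 0 < D := dimSym_pos m
  have hcont := continuous_lowPart r Φ
  have hmass := integral_norm_lowPart_sq hΦ hr htr
  -- The first term integrates to 1 - δ; the constant δ restores total mass 1.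
  let f : SU d → ℝ := fun g => D * ‖lowPart r Φ g‖ ^ 2 + δ
  have hf0 : ∀ g, 0 ≤ f g := fun g => by positivity
  have hfc : Continuous f := by fun_prop
  have hfint : ∫ g, f g ∂haarSU d = 1 := by
    rw [integral_add (integrable_haarSU_real (by fun_prop)) (integrable_const δ),
      integral_const_mul, hmass, hδ_eq]
    simp
  let a : SU d → (Fin k → Fin d) → ℂ := fun g =>
    kroneckerPower (Fin k) g.1 *ᵥ (lowPart r Φ g).ofLp
  let χ : SU d → (Fin k → Fin d) → ℂ := coherentAmplitude Φ
  have ha : Continuous a := continuous_weighted (lowExcitation r) Φ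
  have hχ : Continuous χ := continuous_coherentAmplitude Φ
  set A := average fun g => vecMulVec (a g) (star (a g)) with hA
  set B := average fun g => vecMulVec (χ g - a g) (star (χ g - a g)) with hB
  set S := average (lowProjection r Φ) with hS
  set ρ := reducedMatrix Φ with hρ
  have hBpos : B.PosSemidef := posSemidef_average
    (integrable_entry ((hχ.sub ha).matrix_vecMulVec (hχ.sub ha).star))
    fun g => posSemidef_vecMulVec_self_star _
  have hSpos : S.PosSemidef := posSemidef_average (integrable_lowProjection Φ)
    (posSemidef_lowProjection Φ)
  have hStr : S.trace = 1 := by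
    rw [hS, trace_average (integrable_lowProjection Φ)]
    simp [trace_lowProjection]
  have hAtr : A.trace = (lowMass d k m r : ℂ) := by
    rw [hA, trace_average (integrable_entry (ha.matrix_vecMulVec ha.star)), ← hmass,
      ← integral_complex_ofReal]
    congr 1
    funext g
    rw [trace_vecMulVec, kroneckerPower_mulVec_dotProduct_star, dotProduct_star_self_eq]
  -- Uses |a⟩⟨a| = |a⟩⟨χ| + |χ⟩⟨a| - |χ⟩⟨χ| + |χ - a⟩⟨χ - a|, where the first three terms average to
  -- multiples of ρ.
  have hAB : A = ((2 * lowMass d k m r - D⁻¹ : ℝ) : ℂ) • ρ + B := by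
    have h1 := average_lowPart_coherentAmplitude hΦ hr
    have h2 := average_coherentAmplitude hΦ
    have h3 := congrArg conjTranspose h1
    rw [← average_conjTranspose, conjTranspose_smul, (reducedMatrix_isHermitian Φ).eq,
      Complex.star_def, Complex.conj_ofReal] at h3
    have hc1 : Continuous fun g => vecMulVec (a g) (star (χ g)) := ha.matrix_vecMulVec hχ.star
    have hc2 : Continuous fun g => vecMulVec (χ g) (star (χ g)) := hχ.matrix_vecMulVec hχ.star
    have hc3 : Continuous fun g => vecMulVec (χ g - a g) (star (χ g - a g)) :=
      (hχ.sub ha).matrix_vecMulVec (hχ.sub ha).star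
    have h4 : A = average fun g => (vecMulVec (a g) (star (χ g)) +
        (vecMulVec (a g) (star (χ g)))ᴴ) - vecMulVec (χ g) (star (χ g)) +
        vecMulVec (χ g - a g) (star (χ g - a g)) := by
      rw [hA]
      congr 1
      funext g
      ext u v
      simp only [vecMulVec_apply, Matrix.add_apply, Matrix.sub_apply, conjTranspose_apply,
        Pi.star_apply, Pi.sub_apply, star_sub, star_mul', star_star]
      ring
    have hc4 : Continuous fun g => vecMulVec (a g) (star (χ g)) +
        (vecMulVec (a g) (star (χ g)))ᴴ := hc1.add hc1.matrix_conjTranspose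
    have hc5 : Continuous fun g => vecMulVec (a g) (star (χ g)) +
        (vecMulVec (a g) (star (χ g)))ᴴ - vecMulVec (χ g) (star (χ g)) := hc4.sub hc2
    rw [h4, average_add hc5 hc3, average_sub hc4 hc2, average_add hc1 hc1.matrix_conjTranspose,
      ← hB]
    congr 1
    refine (congrArg₂ (· - ·) (congrArg₂ (· + ·) h1 h3) h2).trans ?_
    rw [← add_smul, ← sub_smul]
    congr 1
    push_cast
    ring
  have hDA : (D : ℂ) • A = ((1 - 2 * δ : ℝ) : ℂ) • ρ + (D : ℂ) • B := by
    rw [hAB, smul_add, smul_smul]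
    congr 2
    rw [← Complex.ofReal_mul, hδ_eq]
    congr 1
    field_simp
    ring
  have hmix : mixture ((haarSU d).withDensity fun g => ENNReal.ofReal (f g))
      (fun g => tensorPower k (g : Matrix (Fin d) (Fin d) ℂ) (lowState r Φ g)) =
      (D : ℂ) • A + (δ : ℂ) • S := by
    ext u v
    have h1 : ∀ g, (ENNReal.ofReal (f g)).toReal • lowProjection r Φ g u v =
        (D : ℂ) * vecMulVec (a g) (star (a g)) u v + (δ : ℂ) * lowProjection r Φ g u v := fun g => by
      rw [ENNReal.toReal_ofReal (hf0 g), ← norm_sq_smul_lowProjection, Matrix.smul_apply,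
        smul_eq_mul, Complex.real_smul]
      simp only [f]
      push_cast
      ring
    refine (integral_withDensity_eq_integral_toReal_smul hfc.measurable.ennreal_ofReal
      (Filter.Eventually.of_forall fun _ => ENNReal.ofReal_lt_top)
      fun g => lowProjection r Φ g u v).trans ?_
    refine (integral_congr_ae (Filter.Eventually.of_forall h1)).trans ?_
    rw [integral_add ((integrable_entry (ha.matrix_vecMulVec ha.star) u v).const_mul _)
      ((integrable_lowProjection Φ u v).const_mul _), integral_const_mul, integral_const_mul]
    rfl
  refine ⟨(haarSU d).withDensity fun g => ENNReal.ofReal (f g), lowState r Φ, ⟨?_⟩,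
    measurable_lowState Φ, fun g => ⟨lowState_mem hΦ g, norm_lowState Φ g⟩, ?_⟩
  · rw [withDensity_apply _ MeasurableSet.univ, Measure.restrict_univ,
      ← ofReal_integral_eq_lintegral_ofReal (integrable_haarSU_real hfc)
        (Filter.Eventually.of_forall hf0), hfint, ENNReal.ofReal_one]
  -- Both positive parts have trace 2δ: on the right D·B and δS contribute δ each.
  · have hdiff : ρ - ((D : ℂ) • A + (δ : ℂ) • S) =
        ((2 * δ : ℝ) : ℂ) • ρ - ((D : ℂ) • B + (δ : ℂ) • S) := by
      rw [hDA, Complex.ofReal_sub, sub_smul, Complex.ofReal_one, one_smul]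
      abel
    have hBtr : ((D : ℂ) • B).trace = ((D * lowMass d k m r - (1 - 2 * δ) : ℝ) : ℂ) := by
      have := congrArg trace hDA
      rw [trace_add, trace_smul, trace_smul ((1 - 2 * δ : ℝ) : ℂ), htr, hAtr, smul_eq_mul,
        smul_eq_mul, mul_one] at this
      push_cast
      rw [this]
      push_cast
      ring
    have hD0 : (0 : ℂ) ≤ (D : ℂ) := by exact_mod_cast hDpos.le
    have hδ0 : (0 : ℂ) ≤ (δ : ℂ) := by exact_mod_cast hδ
    have h2δ : (0 : ℂ) ≤ ((2 * δ : ℝ) : ℂ) := by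
      exact_mod_cast (by positivity : (0 : ℝ) ≤ 2 * δ)
    rw [hmix, hdiff]
    refine (traceNorm_sub_le ((reducedMatrix_posSemidef Φ).smul h2δ)
      ((hBpos.smul hD0).add (hSpos.smul hδ0))).trans (le_of_eq ?_)
    rw [trace_add, hBtr, trace_smul, trace_smul, htr, hStr, smul_eq_mul, smul_eq_mul, mul_one,
      mul_one, Complex.add_re, Complex.ofReal_re, Complex.ofReal_re, Complex.ofReal_re, hδ_eq]
    ring

end Approximation

/-! ### Splitting the factors and the partial trace -/

section Reindex

variable {d n k : ℕ}

/-- The splitting of `n` tensor factors into the first `k` and the last `n - k`. -/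
def splitEquiv (hkn : k ≤ n) : Fin n ≃ Fin k ⊕ Fin (n - k) :=
  (finCongr (Nat.add_sub_of_le hkn).symm).trans finSumFinEquiv.symm

theorem sumElim_comp_splitEquiv (hkn : k ≤ n) (u : Fin k → Fin d) (t : Fin (n - k) → Fin d) :
    Sum.elim u t ∘ splitEquiv hkn =
      Fin.append u t ∘ Fin.cast (Nat.add_sub_of_le hkn).symm := by
  have h : ∀ j : Fin (k + (n - k)), Sum.elim u t (finSumFinEquiv.symm j) = Fin.append u t j :=
    fun j => Fin.addCases (fun i => by simp) (fun i => by simp) j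
  funext i
  exact h _

theorem partialTrace_proj (hkn : k ≤ n) (Ψ : TensorSpace d n) :
    partialTrace hkn (proj Ψ) = reducedMatrix fun w => Ψ (w ∘ splitEquiv hkn) := by
  ext u v
  simp only [partialTrace, proj, reducedMatrix, of_apply, sumElim_comp_splitEquiv]

theorem trace_reducedMatrix (hkn : k ≤ n) {Ψ : TensorSpace d n} (hΨ : ‖Ψ‖ = 1) :
    (reducedMatrix fun w => Ψ (w ∘ splitEquiv hkn)).trace = 1 := by
  have h := dotProduct_star_self_eq Ψ.ofLp
  rw [WithLp.toLp_ofLp, hΨ, one_pow, Complex.ofReal_one, dotProduct,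
    ← (Equiv.arrowCongr (splitEquiv hkn) (Equiv.refl (Fin d))).symm.sum_comp, sum_sumArrow] at h
  exact h

theorem isSymmTensor_comp_splitEquiv (hkn : k ≤ n) {Ψ : TensorSpace d n}
    (hΨ : Ψ ∈ symSubspace d n) : IsSymmTensor fun w => Ψ (w ∘ splitEquiv hkn) := by
  intro π w
  dsimp only
  rw [← hΨ ((splitEquiv hkn).trans (π.trans (splitEquiv hkn).symm)) (w ∘ splitEquiv hkn)]
  refine congrArg Ψ.ofLp (funext fun i => ?_)
  simp

end Reindex

end DeFinetti

theorem corollary5 (d n k r : ℕ) (hd : 1 ≤ d) (hrk : r ≤ k) (hkn : k ≤ n) :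
    (∀ Ψ : DeFinetti.TensorSpace d n, Ψ ∈ DeFinetti.symSubspace d n → ‖Ψ‖ = 1 →
      ∃ (m : MeasureTheory.Measure (DeFinetti.SU d))
        (φ : DeFinetti.SU d → DeFinetti.TensorSpace d k),
        MeasureTheory.IsProbabilityMeasure m ∧ Measurable φ ∧
        (∀ g, φ g ∈ DeFinetti.highWeightSpace d k r ∧ ‖φ g‖ = 1) ∧
        DeFinetti.traceNorm
          (DeFinetti.partialTrace hkn (DeFinetti.proj Ψ) -
            DeFinetti.mixture m (fun g => DeFinetti.tensorPower k (g : Matrix (Fin d) (Fin d) ℂ) (φ g)))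
          ≤ DeFinetti.errorBound n k r d) ∧
    (r = 0 → DeFinetti.errorBound n k 0 d =
      2 * (1 - DeFinetti.dimSym d (n - k) / DeFinetti.dimSym d n)) ∧
    (2 ≤ d → d ≤ min k (n - k) →
      DeFinetti.errorBound n k r d ≤
        2 * (Real.exp (3 * (d : ℝ)) / ((d - 2).factorial : ℝ)) *
          ((k : ℝ) / ((n : ℝ) - (r : ℝ))) ^ (r + 1) *
          (((k : ℝ) * ((n : ℝ) - (k : ℝ))) / ((n : ℝ) - (r : ℝ))) ^ (d - 2)) := by
  have : NeZero d := ⟨by omega⟩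
  refine ⟨fun Ψ hΨ hnorm => ?_, fun _ => ?_, DeFinetti.errorBound_le hrk⟩
  · have heq := DeFinetti.errorBound_eq (d := d) hrk hkn
    have hnn : 0 ≤ DeFinetti.errorBound n k r d := by
      have h1 := (DeFinetti.dimSym_pos (d := d) (n - k)).le
      have h2 := (DeFinetti.dimSym_pos (d := d) n).le
      rw [DeFinetti.errorBound]
      -- Nonnegativity of δ is read off the tail sum defining the error; it makes the density
      -- nonnegative.
      positivity
    rw [DeFinetti.partialTrace_proj, show DeFinetti.errorBound n k r d =
      2 * (DeFinetti.errorBound n k r d / 2) by ring]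
    refine DeFinetti.exists_mixture_of_symm (DeFinetti.isSymmTensor_comp_splitEquiv hkn hΨ) hrk
      (DeFinetti.trace_reducedMatrix hkn hnorm) (by positivity) ?_
    rw [heq, DeFinetti.lowMass, Nat.add_sub_of_le hkn]
    ring
  · rw [DeFinetti.errorBound_eq (Nat.zero_le k) hkn]
    have h := DeFinetti.moment_zero_mul_dimSym (d := d) n
    rw [Finset.sum_range_one, Nat.choose_zero_right, Nat.cast_one, one_mul, Nat.sub_zero,
      eq_one_div_of_mul_eq_one_left h]
    ring
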